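/- All matroids are finite. A matroid $M$ with rank function $r$ is 3-connected if for $k\in\{1,2\}$ there is no $X\subseteq E(M)$ with $|X|,|E(M)-X|\ge k$ and $r(X)+r(E(M)-X)-r(M)<k$. Let $\mathbb{P}:=PG(3,2)$ be the binary matroid on the 15 nonzero vectors of $GF(2)^4$. For a simple binary matroid $N$ of rank at most 4, $\mathbb{P}\backslash N$ denotes $\mathbb{P}\backslash X$, where $X\subseteq E(\mathbb{P})$ is any set with $\mathbb{P}|X\cong N$; for each $N$ below such an $X$ exists and $\mathbb{P}\backslash X$ is, up to isomorphism, independent of its choice. $M(G)$ is the cycle matroid of the graph $G$, $U_{r,n}$ is the uniform matroid of rank $r$ on $n$ elements, $\oplus$ is the direct sum, $P(\cdot,\cdot)$ is the parallel connection, $K_n\backslash e$ is $K_n$ with one edge deleted, and $\mathcal{W}_4$ is the wheel with 4 spokes. $Z_4$ is the matroid represented over $GF(2)$ by $[I_4\,|\,J_4-I_4\,|\,\mathbf{1}]$ ($J_4$ the all-ones matrix, $\mathbf 1$ the all-ones column), $S_8$ is obtained from $Z_4$ by deleting one element corresponding to a column of $J_4-I_4$, $F_7=PG(2,2)$, $AG(3,2)$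 is $\mathbb{P}$ with a hyperplane deleted, and $P_9$ is represented over $GF(2)$ by $$\left[\begin{array}{c|ccccc} &0&1&1&1&1\\ I_4&1&0&1&1&1\\ &1&1&0&1&0\\ &1&1&1&1&0\end{array}\right].$$ **Theorem.** Every matroid in the following list is binary, 3-connected and of rank 4, and every rank-4 binary 3-connected matroid is isomorphic to exactly one matroid in the list: (i) with at most 8 elements: $F_7^*$, $S_8$, $AG(3,2)$ and $M(\mathcal{W}_4)$; (ii) with 9 elements: $Z_4\cong\mathbb{P}\backslash M(K_4)$, $P_9\cong\mathbb{P}\backslash[M(K_4\backslash e)\oplus U_{1,1}]$, $M^*(K_{3,3})\cong\mathbb{P}\backslash[U_{2,3}\oplus U_{2,3}]$ and $M(K_5\backslash e)\cong\mathbb{P}\backslash P(U_{2,3},U_{3,4})$; (iii) with 10 elements: $\mathbb{P}\backslash M(K_4\backslash e)$, $\mathbb{P}\backslash[U_{2,3}\oplus U_{2,2}]$, $\mathbb{P}\backslash[U_{3,4}\oplus U_{1,1}]$ and $M(K_5)\cong\mathbb{P}\backslash U_{4,5}$; (iv) with 11 elements: $\mathbb{P}\backslash[U_{2,3}\oplus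 U_{1,1}]$, $\mathbb{P}\backslash U_{3,4}$ and $\mathbb{P}\backslash U_{4,4}$; (v) with more than 11 elements: $\mathbb{P}\backslash U_{2,3}$, $\mathbb{P}\backslash U_{3,3}$, $\mathbb{P}\backslash U_{2,2}$, $\mathbb{P}\backslash U_{1,1}$ and $\mathbb{P}$ itself. -/

import Mathlib

namespace BinaryMatroids

open Set

universe u v

/-! ### Isomorphism, binary matroids, connectivity -/

/-- Two matroids are isomorphic if there is a bijection between their ground sets under which the
independent sets correspond to each other. -/
def IsIso {α : Type u} {β : Type v} (M : Matroid α) (N : Matroid β) : Prop :=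
  ∃ e : M.E ≃ N.E, ∀ I : Set M.E,
    M.Indep (Subtype.val '' I) ↔ N.Indep (Subtype.val '' (e '' I))

infix:50 " ≅ₘ " => IsIso

/-- A (finite) matroid is binary if it is representable over the field with two elements. -/
def IsBinary {α : Type u} (M : Matroid α) : Prop :=
  ∃ (n : ℕ) (v : α → (Fin n → ZMod 2)),
    ∀ I : Set α, M.Indep I ↔ I ⊆ M.E ∧ LinearIndepOn (ZMod 2) v I

/-- `(X, E(M) - X)` is a `k`-separation of the finite matroid `M`:
both parts have at least `k` elements and `r(X) + r(E(M) - X) - r(M) < k`. -/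
def IsSeparation {α : Type u} (M : Matroid α) (k : ℕ) (X : Set α) : Prop :=
  X ⊆ M.E ∧ (k : ℕ∞) ≤ X.encard ∧ (k : ℕ∞) ≤ (M.E \ X).encard ∧
    M.eRk X + M.eRk (M.E \ X) < M.eRank + k

/-- A finite matroid is `n`-connected (in the sense of Tutte) if it has no `k`-separation with
`1 ≤ k < n`. -/
def IsConnectedOfOrder {α : Type u} (n : ℕ) (M : Matroid α) : Prop :=
  ∀ k : ℕ, 1 ≤ k → k < n → ∀ X : Set α, ¬ IsSeparation M k X

/-! ### Vector matroids, projective geometries -/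

lemma linearIndepOn_augment {F : Type*} {W : Type*} {α : Type*} [Field F] [AddCommGroup W]
    [Module F W] (v : α → W) {I J : Set α} (hIfin : I.Finite) (hJfin : J.Finite)
    (hI : LinearIndepOn F v I) (hJ : LinearIndepOn F v J) (hlt : I.ncard < J.ncard) :
    ∃ e ∈ J, e ∉ I ∧ LinearIndepOn F v (insert e I) := by
  by_contra! hcon
  have hsub : v '' J ⊆ Submodule.span F (v '' I) := by
    rintro _ ⟨e, heJ, rfl⟩
    by_cases heI : e ∈ I
    · exact Submodule.subset_span ⟨e, heI, rfl⟩
    by_contra hns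
    exact hcon e heJ heI (hI.insert hns)
  have key : ∀ K : Set α, K.Finite → LinearIndepOn F v K →
      Module.finrank F (Submodule.span F (v '' K)) = K.ncard := by
    intro K hKfin hK
    have := hKfin.fintype
    have h := finrank_span_eq_card (R := F) (b := fun i : K => v i) hK
    rw [← Nat.card_eq_fintype_card, Nat.card_coe_set_eq] at h
    rw [← h, image_eq_range]
  have : FiniteDimensional F (Submodule.span F (v '' I)) :=
    FiniteDimensional.span_of_finite F (hIfin.image v)
  have hle := Submodule.finrank_mono (Submodule.span_le.2 hsub)
  rw [key I hIfin hI, key J hJfin hJ] at hle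
  omega

/-- The vector matroid over `F` of the family `v`, on the set `E` of labels. -/
def vectorMatroid (F : Type*) {W : Type*} {α : Type u} [Finite α] [Field F] [AddCommGroup W]
    [Module F W] (v : α → W) (E : Set α) : Matroid α :=
  (IndepMatroid.ofFinite E.toFinite (fun I => I ⊆ E ∧ LinearIndepOn F v I)
    ⟨empty_subset _, linearIndepOn_empty F v⟩
    (fun _ _ hJ hIJ => ⟨hIJ.trans hJ.1, hJ.2.mono hIJ⟩)
    (fun I J hI hJ hlt => by
      obtain ⟨e, heJ, heI, h⟩ := linearIndepOn_augment v I.toFinite J.toFinite hI.2 hJ.2 hlt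
      exact ⟨e, heJ, heI, insert_subset (hJ.1 heJ) hI.1, h⟩)
    (fun _ hI => hI.1)).matroid

/-- The binary projective geometry `PG(n, 2)`: over the field with two elements, the points of
projective space are the nonzero vectors. -/
def PG (n : ℕ) : Matroid (Fin (n + 1) → ZMod 2) :=
  vectorMatroid (ZMod 2) id {x | x ≠ 0}

/-- `IsPGComplement M N` says that `M ≅ PG(3,2) \ N`: the matroid `N` is isomorphic to
`PG(3,2)|X` for some set `X` of points and, for every such `X`, `M` is isomorphic to
`PG(3,2) \ X`. -/
def IsPGComplement {α : Type u} {β : Type v} (M : Matroid α) (N : Matroid β) : Prop :=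
  (∃ X ⊆ (PG 3).E, N ≅ₘ (PG 3).restrict X) ∧
    ∀ X ⊆ (PG 3).E, N ≅ₘ (PG 3).restrict X → M ≅ₘ (PG 3).delete X

/-- The matroid `PG(3,2) \ N` exists and is well defined up to isomorphism. -/
def HasPGComplement {β : Type v} (N : Matroid β) : Prop :=
  ∃ C : Matroid (Fin 4 → ZMod 2), IsPGComplement C N

/-! ### Uniform matroids -/

/-- The uniform matroid of rank at most `r` on the set `E`: a subset of `E` is independent if and
only if it has at most `r` elements. -/
def uniformOn {α : Type u} [Finite α] (r : ℕ) (E : Set α) : Matroid α :=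
  (IndepMatroid.ofFinite E.toFinite (fun I => I ⊆ E ∧ I.ncard ≤ r)
    ⟨empty_subset _, by simp⟩
    (fun _ J hJ hIJ => ⟨hIJ.trans hJ.1, (ncard_le_ncard hIJ J.toFinite).trans hJ.2⟩)
    (fun I J hI hJ hlt => by
      obtain ⟨e, heJ, heI⟩ := exists_mem_notMem_of_ncard_lt_ncard hlt I.toFinite
      refine ⟨e, heJ, heI, insert_subset (hJ.1 heJ) hI.1, ?_⟩
      rw [ncard_insert_of_notMem heI I.toFinite]
      have := hJ.2
      omega)
    (fun _ hI => hI.1)).matroid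

/-- The uniform matroid `U_{r,n}`. -/
def U (r n : ℕ) : Matroid (Fin n) := uniformOn r univ

/-! ### Cycle matroids of graphs -/

/-- The column of an edge in the incidence matrix modulo two (zero for a loop). -/
def edgeVec {V : Type u} [DecidableEq V] (e : Sym2 V) : V → ZMod 2 :=
  Sym2.lift ⟨fun a b => Pi.single a 1 + Pi.single b 1, fun _ _ => add_comm _ _⟩ e

lemma edgeVec_mk {V : Type u} [DecidableEq V] (a b : V) :
    edgeVec s(a, b) = Pi.single a 1 + Pi.single b 1 := rfl

lemma single_add_self {V : Type u} [DecidableEq V] (a : V) :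
    (Pi.single a 1 + Pi.single a 1 : V → ZMod 2) = 0 := by
  funext x
  exact CharTwo.add_self_eq_zero _

lemma edgeVec_mem_span_of_reachable {V : Type u} [DecidableEq V] {S : Set (Sym2 V)} {a b : V}
    (h : (SimpleGraph.fromEdgeSet S).Reachable a b) :
    edgeVec s(a, b) ∈ Submodule.span (ZMod 2) (edgeVec '' S) := by
  obtain ⟨w⟩ := h
  induction w with
  | nil =>
    rw [edgeVec_mk, single_add_self]
    exact zero_mem _
  | @cons x y z hxy p ih =>
    have hmem : edgeVec s(x, y) ∈ Submodule.span (ZMod 2) (edgeVec '' S) :=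
      Submodule.subset_span ⟨_, ((SimpleGraph.fromEdgeSet_adj S).1 hxy).1, rfl⟩
    have hsum : edgeVec s(x, z) = edgeVec s(x, y) + edgeVec s(y, z) := by
      simp only [edgeVec_mk]
      calc (Pi.single x 1 + Pi.single z 1 : V → ZMod 2)
          = Pi.single x 1 + (Pi.single y 1 + Pi.single y 1) + Pi.single z 1 := by
            rw [single_add_self, add_zero]
        _ = _ := by abel
    rw [hsum]
    exact add_mem hmem ih

/-- A set of edges of a simple graph is a forest if and only if the corresponding columns of the
incidence matrix are linearly independent modulo two. -/
theorem isAcyclic_iff_linearIndepOn {V : Type u} [DecidableEq V] [Finite V]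
    {G : SimpleGraph V} {I : Set (Sym2 V)} (hI : I ⊆ G.edgeSet) :
    (SimpleGraph.fromEdgeSet I).IsAcyclic ↔ LinearIndepOn (ZMod 2) edgeVec I := by
  classical
  have hdel : ∀ e, (SimpleGraph.fromEdgeSet I).deleteEdges {e} =
      SimpleGraph.fromEdgeSet (I \ {e}) := by
    intro e
    ext a b
    simp only [SimpleGraph.deleteEdges_adj, SimpleGraph.fromEdgeSet_adj, mem_sdiff]
    tauto
  rw [SimpleGraph.isAcyclic_iff_forall_isBridge, linearIndepOn_iff_notMem_span]
  constructor
  · intro h e he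
    induction e with | h a b =>
    have hab : G.Adj a b := hI he
    have hbr := h (e := s(a, b)) (by
      rw [SimpleGraph.mem_edgeSet, SimpleGraph.fromEdgeSet_adj]
      exact ⟨he, hab.ne⟩)
    rw [SimpleGraph.isBridge_iff, hdel] at hbr
    set H := SimpleGraph.fromEdgeSet (I \ {s(a, b)}) with hH
    have := Fintype.ofFinite V
    let χ : V → ZMod 2 := fun x => if H.Reachable a x then 1 else 0
    let φ : (V → ZMod 2) →ₗ[ZMod 2] ZMod 2 := ∑ x, χ x • LinearMap.proj x
    have hφ : ∀ x, φ (Pi.single x 1) = χ x := by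
      intro x
      simp [φ, LinearMap.sum_apply, Pi.single_apply]
    have hker : Submodule.span (ZMod 2) (edgeVec '' (I \ {s(a, b)})) ≤ LinearMap.ker φ := by
      rw [Submodule.span_le]
      rintro _ ⟨f, hf, rfl⟩
      induction f with | h x y =>
      have hxy : H.Adj x y := by
        rw [hH, SimpleGraph.fromEdgeSet_adj]
        exact ⟨hf, SimpleGraph.Adj.ne (hI hf.1)⟩
      have hiff : H.Reachable a x ↔ H.Reachable a y :=
        ⟨fun h => h.trans hxy.reachable, fun h => h.trans hxy.symm.reachable⟩
      have hχ : χ x = χ y := by simp only [χ, hiff]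
      simp only [SetLike.mem_coe, LinearMap.mem_ker, edgeVec_mk, map_add, hφ, hχ]
      exact CharTwo.add_self_eq_zero _
    intro hmem
    have h0 := LinearMap.mem_ker.1 (hker hmem)
    rw [edgeVec_mk, map_add, hφ, hφ] at h0
    simp [χ, hbr] at h0
  · intro h e he
    induction e with | h a b =>
    rw [SimpleGraph.mem_edgeSet, SimpleGraph.fromEdgeSet_adj] at he
    rw [SimpleGraph.isBridge_iff, hdel]
    exact fun hr => h _ he.1 (edgeVec_mem_span_of_reachable hr)

/-- The cycle matroid `M(G)` of a finite simple graph: the independent sets are the edge sets of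
forests. -/
def cycleMatroid {V : Type u} [Finite V] (G : SimpleGraph V) : Matroid (Sym2 V) :=
  (IndepMatroid.ofFinite G.edgeSet.toFinite
    (fun I => I ⊆ G.edgeSet ∧ (SimpleGraph.fromEdgeSet I).IsAcyclic)
    ⟨empty_subset _, by simp⟩
    (fun _ _ hJ hIJ => ⟨hIJ.trans hJ.1, hJ.2.anti (SimpleGraph.fromEdgeSet_mono hIJ)⟩)
    (fun I J hI hJ hlt => by
      classical
      obtain ⟨e, heJ, heI, h⟩ := linearIndepOn_augment (F := ZMod 2) edgeVec I.toFinite J.toFinite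
        ((isAcyclic_iff_linearIndepOn hI.1).1 hI.2) ((isAcyclic_iff_linearIndepOn hJ.1).1 hJ.2) hlt
      have hsub : insert e I ⊆ G.edgeSet := insert_subset (hJ.1 heJ) hI.1
      exact ⟨e, heJ, heI, hsub, (isAcyclic_iff_linearIndepOn hsub).2 h⟩)
    (fun _ hI => hI.1)).matroid

/-- The wheel with `n` spokes (`n ≥ 3`): a cycle of length `n` together with a hub `none` joined
to every vertex of the cycle. -/
def wheelGraph (n : ℕ) : SimpleGraph (Option (Fin n)) :=
  SimpleGraph.starGraph none ⊔ (SimpleGraph.cycleGraph n).map Function.Embedding.some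

/-- The complete graph on `n + 2` vertices with one edge deleted. -/
def completeMinusEdge (n : ℕ) : SimpleGraph (Fin (n + 2)) :=
  (⊤ : SimpleGraph (Fin (n + 2))).deleteEdges {s(0, 1)}

/-! ### Parallel connection -/

/-- The circuits of the parallel connection of `M` and `N` with basepoint `p`. -/
def parallelCircuits {α : Type u} (M N : Matroid α) (p : α) : Set (Set α) :=
  {C | M.IsCircuit C} ∪ {C | N.IsCircuit C} ∪
    {C | ∃ C₁ C₂, M.IsCircuit C₁ ∧ p ∈ C₁ ∧ N.IsCircuit C₂ ∧ p ∈ C₂ ∧ C = (C₁ ∪ C₂) \ {p}}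

lemma parallel_indep_iff {α : Type u} {M N : Matroid α} {p : α} (hp : M.E ∩ N.E = {p})
    {I : Set α} :
    (I ⊆ M.E ∪ N.E ∧ ∀ C ∈ parallelCircuits M N p, ¬ C ⊆ I) ↔
      I ⊆ M.E ∪ N.E ∧ M.Indep (I ∩ M.E) ∧ N.Indep (I ∩ N.E) ∧
        (M.Indep (insert p (I ∩ M.E)) ∨ N.Indep (insert p (I ∩ N.E))) := by
  have hpM : p ∈ M.E := (hp ▸ mem_singleton p : p ∈ M.E ∩ N.E).1
  have hpN : p ∈ N.E := (hp ▸ mem_singleton p : p ∈ M.E ∩ N.E).2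
  refine and_congr_right fun hIE => ⟨fun h => ?_, fun ⟨h1, h2, h3⟩ C hC hCI => ?_⟩
  · have hM : M.Indep (I ∩ M.E) := by
      by_contra hd
      obtain ⟨C, hCI, hC⟩ := (M.not_indep_iff inter_subset_right).1 hd |>.exists_isCircuit_subset
      exact h C (Or.inl (Or.inl hC)) (hCI.trans inter_subset_left)
    have hN : N.Indep (I ∩ N.E) := by
      by_contra hd
      obtain ⟨C, hCI, hC⟩ := (N.not_indep_iff inter_subset_right).1 hd |>.exists_isCircuit_subset
      exact h C (Or.inl (Or.inr hC)) (hCI.trans inter_subset_left)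
    refine ⟨hM, hN, ?_⟩
    by_contra! hcon
    obtain ⟨C₁, hC₁I, hC₁⟩ := (M.not_indep_iff
      (insert_subset hpM inter_subset_right)).1 hcon.1 |>.exists_isCircuit_subset
    obtain ⟨C₂, hC₂I, hC₂⟩ := (N.not_indep_iff
      (insert_subset hpN inter_subset_right)).1 hcon.2 |>.exists_isCircuit_subset
    have hp1 : p ∈ C₁ := by
      by_contra hn
      exact hC₁.not_indep (hM.subset ((subset_insert_iff_of_notMem hn).1 hC₁I))
    have hp2 : p ∈ C₂ := by
      by_contra hn
      exact hC₂.not_indep (hN.subset ((subset_insert_iff_of_notMem hn).1 hC₂I))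
    refine h _ (Or.inr ⟨C₁, C₂, hC₁, hp1, hC₂, hp2, rfl⟩) ?_
    rintro x ⟨hx | hx, hxp⟩
    · exact ((hC₁I hx).resolve_left hxp).1
    · exact ((hC₂I hx).resolve_left hxp).1
  · rcases hC with (hC | hC) | ⟨C₁, C₂, hC₁, hp1, hC₂, hp2, rfl⟩
    · exact hC.not_indep (h1.subset (subset_inter hCI hC.subset_ground))
    · exact hC.not_indep (h2.subset (subset_inter hCI hC.subset_ground))
    · have hs1 : C₁ ⊆ insert p (I ∩ M.E) := fun x hx => by
        by_cases hxp : x = p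
        · exact Or.inl hxp
        · exact Or.inr ⟨hCI ⟨Or.inl hx, hxp⟩, hC₁.subset_ground hx⟩
      have hs2 : C₂ ⊆ insert p (I ∩ N.E) := fun x hx => by
        by_cases hxp : x = p
        · exact Or.inl hxp
        · exact Or.inr ⟨hCI ⟨Or.inr hx, hxp⟩, hC₂.subset_ground hx⟩
      rcases h3 with h3 | h3
      · exact hC₁.not_indep (h3.subset hs1)
      · exact hC₂.not_indep (h3.subset hs2)

lemma ncard_le_of_subset_closure {α : Type u} [Finite α] {M : Matroid α} {I J : Set α}
    (hI : M.Indep I) (hJ : M.Indep J) (h : J ⊆ M.closure I) : J.ncard ≤ I.ncard := by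
  have h1 : J.encard ≤ I.encard := by
    rw [← hJ.eRk_eq_encard, ← hI.eRk_eq_encard, ← M.eRk_closure_eq I]
    exact M.eRk_mono h
  rw [← I.toFinite.cast_ncard_eq, ← J.toFinite.cast_ncard_eq] at h1
  exact_mod_cast h1

lemma ncard_split {α : Type u} [Finite α] {A B : Set α} {p : α} (hp : A ∩ B = {p}) {I : Set α}
    (hI : I ⊆ A ∪ B) :
    (p ∈ I → I.ncard + 1 = (I ∩ A).ncard + (I ∩ B).ncard) ∧
      (p ∉ I → I.ncard = (I ∩ A).ncard + (I ∩ B).ncard) := by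
  have h := ncard_union_add_ncard_inter (I ∩ A) (I ∩ B) (toFinite _) (toFinite _)
  rw [← inter_union_distrib_left, inter_eq_left.2 hI, ← inter_inter_distrib_left, hp] at h
  constructor
  · intro hpI
    rw [inter_eq_right.2 (singleton_subset_iff.2 hpI), ncard_singleton] at h
    exact h
  · intro hpI
    rw [inter_singleton_eq_empty.2 hpI, ncard_empty] at h
    simpa using h

lemma parallel_augment {α : Type u} [Finite α] {M N : Matroid α} {p : α}
    (hp : M.E ∩ N.E = {p}) {I J : Set α}
    (hI : I ⊆ M.E ∪ N.E ∧ M.Indep (I ∩ M.E) ∧ N.Indep (I ∩ N.E) ∧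
        (M.Indep (insert p (I ∩ M.E)) ∨ N.Indep (insert p (I ∩ N.E))))
    (hJ : J ⊆ M.E ∪ N.E ∧ M.Indep (J ∩ M.E) ∧ N.Indep (J ∩ N.E) ∧
        (M.Indep (insert p (J ∩ M.E)) ∨ N.Indep (insert p (J ∩ N.E))))
    (hlt : I.ncard < J.ncard) :
    ∃ e ∈ J, e ∉ I ∧ (insert e I ⊆ M.E ∪ N.E ∧ M.Indep (insert e I ∩ M.E) ∧
      N.Indep (insert e I ∩ N.E) ∧
        (M.Indep (insert p (insert e I ∩ M.E)) ∨ N.Indep (insert p (insert e I ∩ N.E)))) := by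
  have hpM : p ∈ M.E := (hp ▸ mem_singleton p : p ∈ M.E ∩ N.E).1
  have hpN : p ∈ N.E := (hp ▸ mem_singleton p : p ∈ M.E ∩ N.E).2
  have honly : ∀ x, x ∈ M.E → x ∈ N.E → x = p := fun x h1 h2 =>
    mem_singleton_iff.1 (hp ▸ (⟨h1, h2⟩ : x ∈ M.E ∩ N.E))
  by_contra! hcon
  obtain ⟨hIE, hIM, hIN, hIp⟩ := hI
  obtain ⟨hJE, hJM, hJN, hJp⟩ := hJ
  have hsI := ncard_split hp hIE
  have hsJ := ncard_split hp hJE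
  have insM : ∀ e ∈ M.E, insert e I ∩ M.E = insert e (I ∩ M.E) := fun e he =>
    insert_inter_of_mem he
  have insN : ∀ e ∈ N.E, insert e I ∩ N.E = insert e (I ∩ N.E) := fun e he =>
    insert_inter_of_mem he
  have insM' : ∀ e ∉ M.E, insert e I ∩ M.E = I ∩ M.E := fun e he =>
    insert_inter_of_notMem he
  have insN' : ∀ e ∉ N.E, insert e I ∩ N.E = I ∩ N.E := fun e he =>
    insert_inter_of_notMem he
  -- elements of `J` on the side of `M`, when the basepoint may be added on the side of `N`
  have sideM : N.Indep (insert p (I ∩ N.E)) → ∀ x ∈ J ∩ M.E, x ≠ p → x ∈ M.closure (I ∩ M.E) := by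
    intro hN x hx hxp
    by_contra hncl
    have hxI : x ∉ I := fun h => hncl (M.mem_closure_of_mem' ⟨h, hx.2⟩ hx.2)
    have hxN : x ∉ N.E := fun h => hxp (honly x hx.2 h)
    have hins : M.Indep (insert x (I ∩ M.E)) := (hIM.notMem_closure_iff hx.2).1 hncl |>.1
    have := hcon x hx.1 hxI (insert_subset (Or.inl hx.2) hIE) (by rwa [insM x hx.2])
      (by rwa [insN' x hxN])
    exact this.2 (by rwa [insN' x hxN])
  have sideN : M.Indep (insert p (I ∩ M.E)) → ∀ x ∈ J ∩ N.E, x ≠ p → x ∈ N.closure (I ∩ N.E) := by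
    intro hM x hx hxp
    by_contra hncl
    have hxI : x ∉ I := fun h => hncl (N.mem_closure_of_mem' ⟨h, hx.2⟩ hx.2)
    have hxM : x ∉ M.E := fun h => hxp (honly x h hx.2)
    have hins : N.Indep (insert x (I ∩ N.E)) := (hIN.notMem_closure_iff hx.2).1 hncl |>.1
    have := hcon x hx.1 hxI (insert_subset (Or.inr hx.2) hIE) (by rwa [insM' x hxM])
      (by rwa [insN x hx.2])
    exact this.1 (by rwa [insM' x hxM])
  -- with the basepoint added
  have sideM' : M.Indep (insert p (I ∩ M.E)) →
      ∀ x ∈ J ∩ M.E, x ≠ p → x ∈ M.closure (insert p (I ∩ M.E)) := by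
    intro hM x hx hxp
    by_contra hncl
    have hxI : x ∉ I := fun h =>
      hncl (M.mem_closure_of_mem' (Or.inr ⟨h, hx.2⟩) hx.2)
    have hxN : x ∉ N.E := fun h => hxp (honly x hx.2 h)
    have hins : M.Indep (insert x (insert p (I ∩ M.E))) := (hM.notMem_closure_iff hx.2).1 hncl |>.1
    have hins' : M.Indep (insert p (insert x (I ∩ M.E))) := by rwa [insert_comm]
    have := hcon x hx.1 hxI (insert_subset (Or.inl hx.2) hIE)
      (by rw [insM x hx.2]; exact hins'.subset (subset_insert _ _)) (by rwa [insN' x hxN])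
    exact this.1 (by rwa [insM x hx.2])
  have sideN' : N.Indep (insert p (I ∩ N.E)) →
      ∀ x ∈ J ∩ N.E, x ≠ p → x ∈ N.closure (insert p (I ∩ N.E)) := by
    intro hN x hx hxp
    by_contra hncl
    have hxI : x ∉ I := fun h =>
      hncl (N.mem_closure_of_mem' (Or.inr ⟨h, hx.2⟩) hx.2)
    have hxM : x ∉ M.E := fun h => hxp (honly x h hx.2)
    have hins : N.Indep (insert x (insert p (I ∩ N.E))) := (hN.notMem_closure_iff hx.2).1 hncl |>.1
    have hins' : N.Indep (insert p (insert x (I ∩ N.E))) := by rwa [insert_comm]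
    have := hcon x hx.1 hxI (insert_subset (Or.inr hx.2) hIE)
      (by rwa [insM' x hxM]) (by rw [insN x hx.2]; exact hins'.subset (subset_insert _ _))
    exact this.2 (by rwa [insN x hx.2])
  have cardp : ∀ K : Set α, (insert p K).ncard ≤ K.ncard + 1 := fun K => ncard_insert_le p K
  have cardp' : ∀ K : Set α, p ∉ K → (insert p K).ncard = K.ncard + 1 := fun K h =>
    ncard_insert_of_notMem h K.toFinite
  -- the basepoint cannot be added to `I` unless it is spanned on one side
  have hpJI : p ∈ J → p ∉ I → M.Indep (insert p (I ∩ M.E)) → N.Indep (insert p (I ∩ N.E)) →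
      False := by
    intro h1 h2 h3 h4
    have := hcon p h1 h2 (insert_subset (Or.inl hpM) hIE) (by rwa [insM p hpM])
      (by rwa [insN p hpN])
    exact this.1 (by rwa [insM p hpM, insert_idem])
  by_cases hpI : p ∈ I
  · have e1 : insert p (I ∩ M.E) = I ∩ M.E := insert_eq_of_mem ⟨hpI, hpM⟩
    have e2 : insert p (I ∩ N.E) = I ∩ N.E := insert_eq_of_mem ⟨hpI, hpN⟩
    have c1 : insert p (J ∩ M.E) ⊆ M.closure (I ∩ M.E) := by
      rintro x (rfl | hx)
      · exact M.mem_closure_of_mem' ⟨hpI, hpM⟩ hpM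
      by_cases hxp : x = p
      · subst hxp; exact M.mem_closure_of_mem' ⟨hpI, hpM⟩ hpM
      · exact sideM (by rwa [e2]) x hx hxp
    have c2 : insert p (J ∩ N.E) ⊆ N.closure (I ∩ N.E) := by
      rintro x (rfl | hx)
      · exact N.mem_closure_of_mem' ⟨hpI, hpN⟩ hpN
      by_cases hxp : x = p
      · subst hxp; exact N.mem_closure_of_mem' ⟨hpI, hpN⟩ hpN
      · exact sideN (by rwa [e1]) x hx hxp
    have n1 := ncard_le_of_subset_closure hIM hJM ((subset_insert _ _).trans c1)
    have n2 := ncard_le_of_subset_closure hIN hJN ((subset_insert _ _).trans c2)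
    have a := hsI.1 hpI
    by_cases hpJ : p ∈ J
    · have b := hsJ.1 hpJ
      omega
    · have b := hsJ.2 hpJ
      rcases hJp with h | h
      · have := ncard_le_of_subset_closure hIM h c1
        rw [cardp' _ (fun h => hpJ h.1)] at this
        omega
      · have := ncard_le_of_subset_closure hIN h c2
        rw [cardp' _ (fun h => hpJ h.1)] at this
        omega
  · have a := hsI.2 hpI
    by_cases hM : M.Indep (insert p (I ∩ M.E))
    · by_cases hN : N.Indep (insert p (I ∩ N.E))
      · have hpJ : p ∉ J := fun h => hpJI h hpI hM hN
        have n1 := ncard_le_of_subset_closure hIM hJM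
          (fun x hx => sideM hN x hx (fun h => hpJ (h ▸ hx.1)))
        have n2 := ncard_le_of_subset_closure hIN hJN
          (fun x hx => sideN hM x hx (fun h => hpJ (h ▸ hx.1)))
        have b := hsJ.2 hpJ
        omega
      · have hpcl : p ∈ N.closure (I ∩ N.E) := by
          by_contra hn
          exact hN ((hIN.notMem_closure_iff hpN).1 hn).1
        have c2 : insert p (J ∩ N.E) ⊆ N.closure (I ∩ N.E) := by
          rintro x (rfl | hx)
          · exact hpcl
          by_cases hxp : x = p
          · rwa [hxp]
          · exact sideN hM x hx hxp
        have c1 : insert p (J ∩ M.E) ⊆ M.closure (insert p (I ∩ M.E)) := by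
          rintro x (rfl | hx)
          · exact M.mem_closure_of_mem' (Or.inl rfl) hpM
          by_cases hxp : x = p
          · exact M.mem_closure_of_mem' (Or.inl hxp) (hxp ▸ hpM)
          · exact sideM' hM x hx hxp
        have n2 := ncard_le_of_subset_closure hIN hJN ((subset_insert _ _).trans c2)
        have n1 := (ncard_le_of_subset_closure hM hJM ((subset_insert _ _).trans c1)).trans
          (cardp _)
        by_cases hpJ : p ∈ J
        · have b := hsJ.1 hpJ
          omega
        · have b := hsJ.2 hpJ
          rcases hJp with h | h
          · have := (ncard_le_of_subset_closure hM h c1).trans (cardp _)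
            rw [cardp' _ (fun h => hpJ h.1)] at this
            omega
          · have := ncard_le_of_subset_closure hIN h c2
            rw [cardp' _ (fun h => hpJ h.1)] at this
            omega
    · have hN : N.Indep (insert p (I ∩ N.E)) := hIp.resolve_left hM
      have hpcl : p ∈ M.closure (I ∩ M.E) := by
        by_contra hn
        exact hM ((hIM.notMem_closure_iff hpM).1 hn).1
      have c1 : insert p (J ∩ M.E) ⊆ M.closure (I ∩ M.E) := by
        rintro x (rfl | hx)
        · exact hpcl
        by_cases hxp : x = p
        · rwa [hxp]
        · exact sideM hN x hx hxp
      have c2 : insert p (J ∩ N.E) ⊆ N.closure (insert p (I ∩ N.E)) := by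
        rintro x (rfl | hx)
        · exact N.mem_closure_of_mem' (Or.inl rfl) hpN
        by_cases hxp : x = p
        · exact N.mem_closure_of_mem' (Or.inl hxp) (hxp ▸ hpN)
        · exact sideN' hN x hx hxp
      have n1 := ncard_le_of_subset_closure hIM hJM ((subset_insert _ _).trans c1)
      have n2 := (ncard_le_of_subset_closure hN hJN ((subset_insert _ _).trans c2)).trans
        (cardp _)
      by_cases hpJ : p ∈ J
      · have b := hsJ.1 hpJ
        omega
      · have b := hsJ.2 hpJ
        rcases hJp with h | h
        · have := ncard_le_of_subset_closure hIM h c1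
          rw [cardp' _ (fun h => hpJ h.1)] at this
          omega
        · have := (ncard_le_of_subset_closure hN h c2).trans (cardp _)
          rw [cardp' _ (fun h => hpJ h.1)] at this
          omega

/-- The parallel connection `P(M, N)` of two finite matroids whose ground sets meet exactly in the
basepoint `p`, which is not a loop of either: the matroid on `E(M) ∪ E(N)` whose independent sets
are those containing no member of `parallelCircuits M N p`. -/
def parallelConnection {α : Type u} [Finite α] (M N : Matroid α) (p : α)
    (hp : M.E ∩ N.E = {p}) (hM : M.IsNonloop p) (_hN : N.IsNonloop p) : Matroid α :=
  (IndepMatroid.ofFinite (M.E ∪ N.E).toFinite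
    (fun I => I ⊆ M.E ∪ N.E ∧ ∀ C ∈ parallelCircuits M N p, ¬ C ⊆ I)
    ((parallel_indep_iff hp).2 (by simpa using Or.inl hM))
    (fun _ _ hJ hIJ => ⟨hIJ.trans hJ.1, fun C hC h => hJ.2 C hC (h.trans hIJ)⟩)
    (fun I J hI hJ hlt => by
      obtain ⟨e, heJ, heI, h⟩ := parallel_augment hp ((parallel_indep_iff hp).1 hI)
        ((parallel_indep_iff hp).1 hJ) hlt
      exact ⟨e, heJ, heI, (parallel_indep_iff hp).2 h⟩)
    (fun _ hI => hI.1)).matroid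

/-! ### The class and the matroids in the list -/

/-- `M` is a rank-`4` binary `3`-connected matroid. -/
def IsRankFourBinaryThreeConnected {α : Type u} (M : Matroid α) : Prop :=
  IsBinary M ∧ IsConnectedOfOrder 3 M ∧ M.eRank = 4

/-- The Fano matroid `F₇`. -/
def F7 : Matroid (Fin 3 → ZMod 2) := PG 2

/-- The binary affine geometry `AG(3,2)`: a hyperplane is deleted from `PG(3,2)`. -/
def AG32 : Matroid (Fin 4 → ZMod 2) := (PG 3).delete {x | x 0 = 0}

/-- The binary spike `Z_r`, represented by `[I_r | J_r - I_r | 1]`. The labels `a_i`, `b_i`, `c`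
are `inl i`, `inr (inl i)`, `inr (inr ())`. -/
def Z (r : ℕ) : Matroid (Fin r ⊕ (Fin r ⊕ Unit)) :=
  vectorMatroid (ZMod 2)
    (Sum.elim (fun i j => if i = j then 1 else 0)
      (Sum.elim (fun i j => if i = j then 0 else 1) (fun _ _ => 1)) :
      Fin r ⊕ (Fin r ⊕ Unit) → (Fin r → ZMod 2)) univ

/-- `S₈` is the spike `Z₄` with the element `b₄` deleted. -/
def S8 : Matroid (Fin 4 ⊕ (Fin 4 ⊕ Unit)) := (Z 4).delete {Sum.inr (Sum.inl 3)}

/-- The matrix over the field with two elements that represents `P₉`. -/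
def P9Matrix : Matrix (Fin 4) (Fin 9) (ZMod 2) :=
  !![1, 0, 0, 0, 0, 1, 1, 1, 1;
     0, 1, 0, 0, 1, 0, 1, 1, 1;
     0, 0, 1, 0, 1, 1, 0, 1, 0;
     0, 0, 0, 1, 1, 1, 1, 1, 0]

/-- The matroid `P₉`. -/
def P9 : Matroid (Fin 9) := vectorMatroid (ZMod 2) P9Matrix.col univ

/-- The parallel connection `P(U_{2,3}, U_{3,4})`. -/
def PU23U34 : Matroid (Fin 6) :=
  parallelConnection (uniformOn 2 ({0, 1, 2} : Set (Fin 6)))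
    (uniformOn 3 ({2, 3, 4, 5} : Set (Fin 6))) 2
    (by
      change ({0, 1, 2} : Set (Fin 6)) ∩ {2, 3, 4, 5} = {2}
      ext x
      simp only [mem_inter_iff, mem_insert_iff, mem_singleton_iff]
      fin_cases x <;> simp)
    (by
      rw [← Matroid.indep_singleton]
      exact ⟨by simp, by simp⟩)
    (by
      rw [← Matroid.indep_singleton]
      exact ⟨by simp, by simp⟩)

end BinaryMatroids

open BinaryMatroids

open BinaryMatroids

namespace BinaryMatroids

open Set

/-! A rank-4 binary 3-connected matroid has no loops and no parallel pairs, so it is a set `S` of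
points of PG(3,2). In rank 4, 3-connectivity of such a set is equivalent to every hyperplane missing
at least three points of `S` (`isRankFourBinaryThreeConnected_iff`). A hyperplane missing fewer than
three gives a separation at once. Conversely, in a separation of order at most 2 one side has rank
at most 2. If the other side spans, the small side has too few points for its rank. Otherwise the
other side lies in a hyperplane, and the three or more points off it would lie in a plane of vectors
(dimension 2) together with 0 and a sum of two of them, which is too many.

Binary representations are unique up to a linear automorphism (`Represents.exists_linearEquiv`), so
isomorphism of matroids is projective equivalence of point sets, and equally of their complements.
It remains to list the orbits of sets `X` of deleted points whose complement satisfies the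
hyperplane condition. The condition passes to subsets of `X`, so every admissible `X` is reached
from the empty set by adding points one at a time. A finite table (`stepValid_all`) shows that each
such step leads from one of 20 representatives to an equivalent of another, or violates the
condition; `lineInvariant` separates the 20.

Each matroid named in the list is then given an explicit representation whose image is one of the
representatives or the complement of one. The representatives are numbered in the order of the list.
-/

/-- The family `v` of vectors over the field with two elements represents `M`. -/
def Represents {α W : Type*} [AddCommGroup W] [Module (ZMod 2) W] (v : α → W)
    (M : Matroid α) : Prop :=
  ∀ I : Set α, M.Indep I ↔ I ⊆ M.E ∧ LinearIndepOn (ZMod 2) v I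

/-! ### Representations over GF(2) and their uniqueness -/

section General

variable {α β W W' : Type*} [AddCommGroup W] [Module (ZMod 2) W] [AddCommGroup W']
  [Module (ZMod 2) W']

lemma zmod_two_eq_zero_or_one (a : ZMod 2) : a = 0 ∨ a = 1 := by
  revert a; decide

lemma sum_smul_eq_sum_filter (v : α → W) (t : Finset α) (c : α → ZMod 2) :
    ∑ x ∈ t, c x • v x = ∑ x ∈ t.filter (fun x => c x = 1), v x := by
  rw [Finset.sum_filter]
  refine Finset.sum_congr rfl fun x _ => ?_
  rcases zmod_two_eq_zero_or_one (c x) with h | h <;> simp [h]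

/-- Over the field with two elements, a family is independent on `I` if and only if no nonempty
finite subfamily sums to zero. -/
lemma linearIndepOn_iff_sum_ne_zero {v : α → W} {I : Set α} :
    LinearIndepOn (ZMod 2) v I ↔
      ∀ J : Finset α, (J : Set α) ⊆ I → J.Nonempty → ∑ x ∈ J, v x ≠ 0 := by
  classical
  rw [linearIndepOn_iff']
  constructor
  · intro h J hJ hne h0
    obtain ⟨x, hx⟩ := hne
    have := h J (fun _ => 1) hJ (by simpa using h0) x hx
    exact one_ne_zero this
  · intro h t c ht h0 x hx
    by_contra hc
    rw [sum_smul_eq_sum_filter] at h0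
    refine h _ (fun y hy => ht (Finset.mem_filter.1 hy).1) ⟨x, ?_⟩ h0
    exact Finset.mem_filter.2 ⟨hx, (zmod_two_eq_zero_or_one _).resolve_left hc⟩

lemma Represents.eRk_eq {v : α → W} {M : Matroid α} [M.Finite] (h : Represents v M) {X : Set α}
    (hX : X ⊆ M.E) :
    M.eRk X = (Module.finrank (ZMod 2) (Submodule.span (ZMod 2) (v '' X)) : ℕ∞) := by
  obtain ⟨I, hI⟩ := M.exists_isBasis X
  have hfin : I.Finite := M.ground_finite.subset (hI.subset.trans hX)
  have hspan : Submodule.span (ZMod 2) (v '' I) = Submodule.span (ZMod 2) (v '' X) := by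
    refine le_antisymm (Submodule.span_mono (image_mono hI.subset)) (Submodule.span_le.2 ?_)
    rintro _ ⟨e, he, rfl⟩
    by_cases heI : e ∈ I
    · exact Submodule.subset_span ⟨e, heI, rfl⟩
    by_contra hns
    refine heI (hI.mem_of_insert_indep he ((h _).2 ⟨insert_subset (hX he)
      (hI.subset.trans hX), ?_⟩))
    exact ((h I).1 hI.indep).2.insert hns
  have := hfin.fintype
  have hc := finrank_span_eq_card (R := ZMod 2) (b := fun i : I => v i) ((h I).1 hI.indep).2
  rw [← Nat.card_eq_fintype_card, Nat.card_coe_set_eq, ← image_eq_range, hspan] at hc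
  rw [← hI.encard_eq_eRk, hc, hfin.cast_ncard_eq]

lemma Represents.map {v : α → W} {M : Matroid α} (h : Represents v M) (f : W →ₗ[ZMod 2] W')
    (hf : InjOn f (Submodule.span (ZMod 2) (v '' M.E))) : Represents (f ∘ v) M := by
  intro I
  rw [h I]
  refine and_congr_right fun hI => ?_
  rw [LinearMap.linearIndepOn_iff_of_injOn f]
  exact hf.mono (Submodule.span_mono (image_mono hI))

lemma Represents.congr {v w : α → W} {M : Matroid α} (h : Represents v M)
    (hvw : EqOn v w M.E) : Represents w M := by
  intro I
  rw [h I]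
  exact and_congr_right fun hI => linearIndepOn_congr (hvw.mono hI)

/-- Some nonempty subfamily of a circuit sums to zero. It is dependent, hence by minimality it is
the whole circuit. -/
lemma Represents.sum_isCircuit_eq_zero {v : α → W} {M : Matroid α} (hv : Represents v M)
    {C : Finset α} (hC : M.IsCircuit (C : Set α)) : ∑ x ∈ C, v x = 0 := by
  have hdep : ¬ LinearIndepOn (ZMod 2) v (C : Set α) := fun h =>
    hC.not_indep ((hv _).2 ⟨hC.subset_ground, h⟩)
  rw [linearIndepOn_iff_sum_ne_zero] at hdep
  push Not at hdep
  obtain ⟨K, hKC, hne, hK⟩ := hdep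
  have : ¬ M.Indep (K : Set α) := fun h =>
    linearIndepOn_iff_sum_ne_zero.1 ((hv _).1 h).2 K subset_rfl hne hK
  rw [← Finset.coe_inj.1 (hC.eq_of_not_indep_subset this hKC), hK]

/-- A binary matroid determines which sums of representing vectors vanish. -/
lemma Represents.sum_eq_zero {v : α → W} {w : α → W'} {M : Matroid α} (hv : Represents v M)
    (hw : Represents w M) (J : Finset α) (hJ : (J : Set α) ⊆ M.E) (h0 : ∑ x ∈ J, v x = 0) :
    ∑ x ∈ J, w x = 0 := by
  classical
  induction J using Finset.strongInduction with
  | H J ih =>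
  rcases J.eq_empty_or_nonempty with rfl | hne
  · simp
  have hdep : M.Dep (J : Set α) := by
    refine ⟨fun h => ?_, hJ⟩
    exact linearIndepOn_iff_sum_ne_zero.1 ((hv _).1 h).2 J subset_rfl hne h0
  -- A circuit inside `J` sums to zero under both representations, so it can be removed; the rest of
  -- `J` still has zero `v`-sum and is smaller.
  obtain ⟨C, hCJ, hC⟩ := hdep.exists_isCircuit_subset
  lift C to Finset α using J.finite_toSet.subset hCJ
  have hCJ' : C ⊆ J := by exact_mod_cast hCJ
  have hCne : C.Nonempty := by exact_mod_cast hC.nonempty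
  have hv' := Finset.sum_sdiff (f := v) hCJ'
  have hw' := Finset.sum_sdiff (f := w) hCJ'
  rw [hv.sum_isCircuit_eq_zero hC, h0, add_zero] at hv'
  rw [hw.sum_isCircuit_eq_zero hC, add_zero] at hw'
  rw [← hw']
  refine ih _ (Finset.sdiff_ssubset hCJ' hCne) (fun x hx => hJ ?_) hv'
  exact (Finset.mem_sdiff.1 hx).1

/-- Binary matroids are uniquely representable over the field with two elements. -/
theorem Represents.exists_linearEquiv [Module.Finite (ZMod 2) W] {v w : α → W} {M : Matroid α}
    [M.Finite] (hv : Represents v M) (hw : Represents w M) :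
    ∃ g : W ≃ₗ[ZMod 2] W, ∀ e ∈ M.E, g (v e) = w e := by
  classical
  have := M.ground_finite.fintype
  -- `L u` sends a coefficient vector to the corresponding combination of the `u e`. Its kernel is
  -- the space of relations, which the matroid determines.
  let L : (α → W) → (M.E → ZMod 2) →ₗ[ZMod 2] W := fun u =>
    Fintype.linearCombination (ZMod 2) (fun e : M.E => u e)
  have hL : ∀ (u : α → W) (c : M.E → ZMod 2),
      L u c = ∑ x ∈ (Finset.univ.filter (fun e => c e = 1)).map (Function.Embedding.subtype _),
        u x := by
    intro u c
    rw [Finset.sum_map]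
    simp only [L, Fintype.linearCombination_apply]
    rw [sum_smul_eq_sum_filter]
    rfl
  have hsub : ∀ c : M.E → ZMod 2, ((((Finset.univ.filter (fun e => c e = 1)).map
      (Function.Embedding.subtype _) : Finset α)) : Set α) ⊆ M.E := by
    intro c x hx
    simp only [Finset.coe_map, mem_image] at hx
    obtain ⟨y, -, rfl⟩ := hx
    exact y.2
  have hker : LinearMap.ker (L v) = LinearMap.ker (L w) := by
    ext c
    rw [LinearMap.mem_ker, LinearMap.mem_ker, hL, hL]
    exact ⟨hv.sum_eq_zero hw _ (hsub c), hw.sum_eq_zero hv _ (hsub c)⟩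
  -- Both spans are quotients by the same space of relations, so they are matched by a linear
  -- equivalence, and this extends to all of `W`.
  obtain ⟨g, hg⟩ := Submodule.exists_linearEquiv_restrict_eq
    ((L v).quotKerEquivRange.symm ≪≫ₗ Submodule.quotEquivOfEq _ _ hker ≪≫ₗ
      (L w).quotKerEquivRange)
  refine ⟨g, fun e he => ?_⟩
  have hsingle : ∀ u : α → W, L u (Pi.single ⟨e, he⟩ 1) = u e := fun u => by
    simp [L, Fintype.linearCombination_apply_single]
  have h := hg ⟨L v (Pi.single ⟨e, he⟩ 1), LinearMap.mem_range_self _ _⟩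
  rw [← hsingle v, ← hsingle w, ← h]
  simp only [LinearEquiv.trans_apply]
  rw [show (⟨L v (Pi.single ⟨e, he⟩ 1), LinearMap.mem_range_self _ _⟩ : LinearMap.range (L v)) =
    (L v).quotKerEquivRange (Submodule.Quotient.mk (Pi.single ⟨e, he⟩ 1)) from
      Subtype.ext ((L v).quotKerEquivRange_apply_mk _).symm, LinearEquiv.symm_apply_apply,
    Submodule.quotEquivOfEq_mk, LinearMap.quotKerEquivRange_apply_mk]

lemma vectorMatroid_represents [Finite α] (v : α → W) (E : Set α) :
    Represents v (vectorMatroid (ZMod 2) v E) := fun _ => Iff.rfl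

/-- A matroid is isomorphic to the matroid on a set of points of a binary projective geometry if
and only if it has an injective representation with this image. -/
theorem isIso_restrict_PG_iff {n : ℕ} {M : Matroid α} {S : Set (Fin (n + 1) → ZMod 2)}
    (hS : S ⊆ {x | x ≠ 0}) :
    M ≅ₘ (PG n).restrict S ↔
      ∃ v : α → (Fin (n + 1) → ZMod 2), Represents v M ∧ InjOn v M.E ∧ v '' M.E = S := by
  classical
  have hPG : ∀ I, ((PG n).restrict S).Indep I ↔ I ⊆ S ∧ LinearIndepOn (ZMod 2) id I := by
    intro I
    rw [Matroid.restrict_indep_iff]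
    exact ⟨fun h => ⟨h.2, h.1.2⟩, fun h => ⟨⟨h.1.trans hS, h.2⟩, h.1⟩⟩
  constructor
  · rintro ⟨e, he⟩
    let v : α → (Fin (n + 1) → ZMod 2) := fun x => if h : x ∈ M.E then (e ⟨x, h⟩).1 else 0
    have hve : ∀ x : M.E, v x = (e x).1 := fun x => by simp [v]
    have hinj : InjOn v M.E := by
      intro x hx y hy hxy
      have := hve ⟨x, hx⟩
      have h2 := hve ⟨y, hy⟩
      simp only at this h2
      rw [this, h2] at hxy
      simpa using e.injective (Subtype.ext hxy)
    refine ⟨v, fun I => ?_, hinj, ?_⟩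
    · by_cases hI : I ⊆ M.E
      · have hIv : (Subtype.val '' (Subtype.val ⁻¹' I : Set M.E)) = I := by
          rw [Subtype.image_preimage_coe, inter_eq_right.2 hI]
        have him : Subtype.val '' (e '' (Subtype.val ⁻¹' I : Set M.E)) = v '' I := by
          conv_rhs => rw [← hIv]
          simp only [image_image, hve]
        have h := he (Subtype.val ⁻¹' I)
        rw [hIv, him, hPG, ← linearIndepOn_iff_image (hinj.mono hI)] at h
        rw [h]
        refine and_congr_left fun _ => iff_of_true ?_ hI
        rw [← him]
        rintro _ ⟨y, -, rfl⟩
        exact y.2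
      · exact iff_of_false (fun h => hI h.subset_ground) (fun h => hI h.1)
    · ext y
      constructor
      · rintro ⟨x, hx, rfl⟩
        have := hve ⟨x, hx⟩
        simp only at this
        rw [this]
        exact (e ⟨x, hx⟩).2
      · intro hy
        refine ⟨e.symm ⟨y, hy⟩, Subtype.coe_prop _, ?_⟩
        rw [hve, Equiv.apply_symm_apply]
  · rintro ⟨v, hv, hinj, him⟩
    have hbij : BijOn v M.E ((PG n).restrict S).E := him ▸ hinj.bijOn_image
    refine ⟨hbij.equiv v, fun I => ?_⟩
    have hsub : Subtype.val '' I ⊆ M.E := by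
      rintro _ ⟨y, -, rfl⟩
      exact y.2
    have him' : Subtype.val '' (hbij.equiv v '' I) = v '' (Subtype.val '' I) := by
      simp only [image_image]
      rfl
    rw [him', hv, hPG, ← linearIndepOn_iff_image (hinj.mono hsub), ← him]
    exact and_congr_left fun _ => iff_of_true hsub (image_mono hsub)

lemma isIso_symm {M : Matroid α} {N : Matroid β} (h : M ≅ₘ N) : N ≅ₘ M := by
  obtain ⟨e, he⟩ := h
  refine ⟨e.symm, fun I => ?_⟩
  rw [he, ← image_comp, ← image_comp]
  simp

lemma isIso_trans {γ : Type*} {M : Matroid α} {N : Matroid β} {K : Matroid γ} (h : M ≅ₘ N)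
    (h' : N ≅ₘ K) : M ≅ₘ K := by
  obtain ⟨e, he⟩ := h
  obtain ⟨f, hf⟩ := h'
  refine ⟨e.trans f, fun I => ?_⟩
  rw [he, hf, Equiv.coe_trans, image_comp]

lemma isIso_congr_right {γ : Type*} {M : Matroid α} {N : Matroid β} {K : Matroid γ}
    (h : N ≅ₘ K) : M ≅ₘ N ↔ M ≅ₘ K :=
  ⟨fun h' => isIso_trans h' h, fun h' => isIso_trans h' (isIso_symm h)⟩

end General

/-! ### 3-connectivity in rank 4 as a condition on hyperplanes -/

/-- The points of `PG(3, 2)` are the nonzero vectors of this space. -/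
abbrev V4 : Type := Fin 4 → ZMod 2

/-- Every hyperplane misses at least three members of `S`. -/
def HasLargeCocircuits (S : Finset V4) : Prop :=
  ∀ φ : V4 →ₗ[ZMod 2] ZMod 2, φ ≠ 0 → 3 ≤ (S.filter (fun x => φ x = 1)).card

/-- This heredity allows the enumeration point by point: if a set of points may be deleted, so may
each of its subsets. -/
lemma HasLargeCocircuits.mono {S T : Finset V4} (h : HasLargeCocircuits S) (hST : S ⊆ T) :
    HasLargeCocircuits T := fun φ hφ =>
  (h φ hφ).trans (Finset.card_le_card (Finset.filter_subset_filter _ hST))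

lemma card_le_two_pow_finrank (P : Submodule (ZMod 2) V4) (A : Finset V4) (h : ∀ x ∈ A, x ∈ P) :
    A.card ≤ 2 ^ Module.finrank (ZMod 2) P := by
  classical
  have h1 := Module.natCard_eq_pow_finrank (K := ZMod 2) (V := P)
  rw [Nat.card_zmod] at h1
  rw [← h1, ← Nat.card_eq_finsetCard A]
  exact Nat.card_mono (t := (P : Set V4)) (s := (A : Set V4)) (toFinite _) h

lemma exists_le_ker_of_finrank_lt (P : Submodule (ZMod 2) V4)
    (h : Module.finrank (ZMod 2) P < 4) :
    ∃ φ : V4 →ₗ[ZMod 2] ZMod 2, φ ≠ 0 ∧ P ≤ LinearMap.ker φ := by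
  refine P.exists_le_ker_of_lt_top (lt_top_iff_ne_top.2 ?_)
  rintro rfl
  simp at h

lemma finrank_ker_lt (φ : V4 →ₗ[ZMod 2] ZMod 2) (hφ : φ ≠ 0) :
    Module.finrank (ZMod 2) (LinearMap.ker φ) < 4 := by
  have := Submodule.finrank_lt (s := LinearMap.ker φ) (by
    rwa [Ne, LinearMap.ker_eq_top])
  simpa using this

/-- A loopless binary matroid without parallel elements, of rank at most `4`, given by points
meeting the complement of every hyperplane at least three times, is `3`-connected. -/
lemma isConnectedOfOrder_three {α : Type*} {M : Matroid α} [M.Finite] {v : α → V4}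
    (hv : Represents v M) (hinj : InjOn v M.E) (h0 : ∀ e ∈ M.E, v e ≠ 0)
    (hlarge : ∀ φ : V4 →ₗ[ZMod 2] ZMod 2, φ ≠ 0 →
      ∃ T : Finset V4, 3 ≤ T.card ∧ ∀ x ∈ T, φ x = 1 ∧ x ∈ v '' M.E)
    (hrank : M.eRank = 4) : IsConnectedOfOrder 3 M := by
  classical
  -- `X` is the side of rank at most 2.
  have main : ∀ k : ℕ, k < 3 → ∀ X ⊆ M.E, (k : ℕ∞) ≤ X.encard →
      Module.finrank (ZMod 2) (Submodule.span (ZMod 2) (v '' X)) ≤ 2 →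
      Module.finrank (ZMod 2) (Submodule.span (ZMod 2) (v '' X)) +
        Module.finrank (ZMod 2) (Submodule.span (ZMod 2) (v '' (M.E \ X))) < 4 + k → False := by
    intro k hk X hX hkX hX2 hlt
    set a := Module.finrank (ZMod 2) (Submodule.span (ZMod 2) (v '' X)) with ha
    by_cases hb : Module.finrank (ZMod 2) (Submodule.span (ZMod 2) (v '' (M.E \ X))) < 4
    · obtain ⟨φ, hφ, hker⟩ := exists_le_ker_of_finrank_lt _ hb
      obtain ⟨T, hT, hTφ⟩ := hlarge φ hφ
      have hTX : ∀ x ∈ T, x ∈ Submodule.span (ZMod 2) (v '' X) := by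
        intro x hx
        obtain ⟨h1, e, he, rfl⟩ := hTφ x hx
        by_cases heX : e ∈ X
        · exact Submodule.subset_span ⟨e, heX, rfl⟩
        · have := hker (Submodule.subset_span ⟨e, ⟨he, heX⟩, rfl⟩)
          rw [LinearMap.mem_ker, h1] at this
          exact absurd this one_ne_zero
      -- The other side lies in the hyperplane `ker φ`, so all of `T` lies in the span of `X`. So do
      -- `0` and `x + y`, which lie in the hyperplane and hence outside `T`: at least five vectors
      -- in a space of dimension at most 2.
      obtain ⟨x, y, hx, hy, hxy⟩ := Finset.one_lt_card_iff.1 (by omega : 1 < T.card)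
      have h00 : (0 : V4) ∉ insert (x + y) T := by
        rw [Finset.mem_insert]
        rintro (h | h)
        · exact hxy (CharTwo.add_eq_zero.1 h.symm)
        · simpa using (hTφ _ h).1
      have hxyT : x + y ∉ T := fun h => by
        have := (hTφ _ h).1
        rw [map_add, (hTφ x hx).1, (hTφ y hy).1] at this
        revert this
        decide
      have := card_le_two_pow_finrank (Submodule.span (ZMod 2) (v '' X))
        (insert 0 (insert (x + y) T)) (by
          intro z hz
          rw [Finset.mem_insert, Finset.mem_insert] at hz
          rcases hz with rfl | rfl | hz
          · exact zero_mem _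
          · exact add_mem (hTX x hx) (hTX y hy)
          · exact hTX z hz)
      rw [Finset.card_insert_of_notMem h00, Finset.card_insert_of_notMem hxyT] at this
      have h4 : 2 ^ Module.finrank (ZMod 2) (Submodule.span (ZMod 2) (v '' X)) ≤ 2 ^ 2 :=
        Nat.pow_le_pow_right (by norm_num) hX2
      omega
    -- The other side spans, so `a < k`. Distinct nonzero vectors give `X.encard ≤ 2 ^ a - 1`, which
    -- is below `k` for `a < k ≤ 2`.
    · have hfin : X.Finite := M.ground_finite.subset hX
      have h00 : (0 : V4) ∉ hfin.toFinset.image v := by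
        rw [Finset.mem_image]
        rintro ⟨e, he, h⟩
        exact h0 e (hX (hfin.mem_toFinset.1 he)) h
      have := card_le_two_pow_finrank (Submodule.span (ZMod 2) (v '' X))
        (insert 0 (hfin.toFinset.image v)) (by
          intro z hz
          rw [Finset.mem_insert, Finset.mem_image] at hz
          rcases hz with rfl | ⟨e, he, rfl⟩
          · exact zero_mem _
          · exact Submodule.subset_span ⟨e, hfin.mem_toFinset.1 he, rfl⟩)
      rw [Finset.card_insert_of_notMem h00, Finset.card_image_of_injOn (by
        rw [hfin.coe_toFinset]; exact hinj.mono hX), ← ha] at this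
      rw [hfin.encard_eq_coe_toFinset_card] at hkX
      have hkX' : k ≤ hfin.toFinset.card := by exact_mod_cast hkX
      have hak : a < k := by omega
      interval_cases k <;> interval_cases a <;> omega
  rintro k hk1 hk3 X ⟨hX, hkX, hkY, hlt⟩
  rw [hv.eRk_eq hX, hv.eRk_eq sdiff_subset, hrank] at hlt
  have hlt' : Module.finrank (ZMod 2) (Submodule.span (ZMod 2) (v '' X)) +
        Module.finrank (ZMod 2) (Submodule.span (ZMod 2) (v '' (M.E \ X))) < 4 + k := by
    exact_mod_cast hlt
  -- The two ranks add up to less than `4 + k ≤ 6`, so they cannot both be at least 3.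
  by_cases hX2 : Module.finrank (ZMod 2) (Submodule.span (ZMod 2) (v '' X)) ≤ 2
  · exact main k hk3 X hX hkX hX2 hlt'
  · refine main k hk3 (M.E \ X) sdiff_subset hkY (by omega) ?_
    rw [sdiff_sdiff_cancel_left hX]
    omega

/-- A binary matroid of rank `4` has a representation in the four-dimensional space. -/
lemma IsBinary.exists_represents {α : Type*} {M : Matroid α} [M.Finite] (h : IsBinary M)
    (hrank : M.eRank = 4) : ∃ w : α → V4, Represents w M := by
  obtain ⟨n, v, hv⟩ := h
  have hv' : Represents v M := hv
  have hfr : Module.finrank (ZMod 2) (Submodule.span (ZMod 2) (v '' M.E)) = 4 := by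
    have := hv'.eRk_eq subset_rfl
    rw [← Matroid.eRank_def, hrank] at this
    exact_mod_cast this.symm
  obtain ⟨f⟩ := FiniteDimensional.nonempty_linearEquiv_of_finrank_eq
    (R := ZMod 2) (M := Submodule.span (ZMod 2) (v '' M.E)) (M' := V4) (by rw [hfr]; simp)
  obtain ⟨F, hF⟩ := LinearMap.exists_extend f.toLinearMap
  refine ⟨F ∘ v, hv'.map F ?_⟩
  intro x hx y hy hxy
  have hFx : ∀ z : Submodule.span (ZMod 2) (v '' M.E), F z = f z := fun z =>
    LinearMap.congr_fun hF z
  have := f.injective (((hFx ⟨x, hx⟩).symm.trans hxy).trans (hFx ⟨y, hy⟩))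
  simpa using this

/-- A loop would be a 1-separation and a parallel pair a 2-separation, the ground set having at
least four elements. -/
lemma IsConnectedOfOrder.ne_zero_and_injOn {α : Type*} {M : Matroid α} [M.Finite] {w : α → V4}
    (hw : Represents w M) (hconn : IsConnectedOfOrder 3 M) (hrank : M.eRank = 4) :
    (∀ e ∈ M.E, w e ≠ 0) ∧ InjOn w M.E := by
  have hE : (4 : ℕ∞) ≤ M.E.encard := by
    rw [← hrank, Matroid.eRank_def]
    exact M.eRk_le_encard M.E
  have hle : ∀ X, M.eRk X ≤ 4 := fun X => hrank ▸ M.eRk_le_eRank X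
  have hsz : ∀ X ⊆ M.E, (M.E \ X).ncard + X.ncard = M.E.ncard := fun X hX =>
    ncard_sdiff_add_ncard_of_subset hX M.ground_finite
  have hfin : ∀ X ⊆ M.E, X.encard = X.ncard := fun X hX =>
    (M.ground_finite.subset hX).cast_ncard_eq.symm
  have hE' : 4 ≤ M.E.ncard := by
    rw [hfin _ subset_rfl] at hE
    exact_mod_cast hE
  constructor
  · intro e he h0
    have hsub : {e} ⊆ M.E := singleton_subset_iff.2 he
    have hr : M.eRk {e} = 0 := by
      rw [hw.eRk_eq hsub]
      simp [h0]
    refine hconn 1 le_rfl (by norm_num) {e} ⟨hsub, by simp, ?_, ?_⟩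
    · have := hsz _ hsub
      rw [ncard_singleton] at this
      rw [hfin _ sdiff_subset]
      exact_mod_cast (by omega)
    · rw [hr, hrank, zero_add]
      exact (hle _).trans_lt (by norm_num)
  · intro e he f hf hef
    by_contra hne
    have hsub : {e, f} ⊆ M.E := insert_subset he (singleton_subset_iff.2 hf)
    have hr : M.eRk {e, f} ≤ 1 := by
      rw [hw.eRk_eq hsub, image_pair, ← hef, pair_eq_singleton]
      exact_mod_cast (finrank_span_le_card {w e}).trans (by simp)
    refine hconn 2 (by norm_num) (by norm_num) {e, f} ⟨hsub, by simp [encard_pair hne], ?_, ?_⟩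
    · have := hsz _ hsub
      rw [ncard_pair hne] at this
      rw [hfin _ sdiff_subset]
      exact_mod_cast (by omega)
    · rw [hrank]
      exact (add_le_add hr (hle _)).trans_lt (by norm_num)

theorem isRankFourBinaryThreeConnected_iff {α : Type*} {M : Matroid α} [M.Finite] :
    IsRankFourBinaryThreeConnected M ↔
      ∃ S : Finset V4, 0 ∉ S ∧ HasLargeCocircuits S ∧ M ≅ₘ (PG 3).restrict (S : Set V4) := by
  classical
  constructor
  · rintro ⟨hbin, hconn, hrank⟩
    obtain ⟨w, hw⟩ := hbin.exists_represents hrank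
    obtain ⟨h0, hinj⟩ := hconn.ne_zero_and_injOn hw hrank
    have hfin := M.ground_finite
    have hE : (4 : ℕ∞) ≤ M.E.encard := by
      rw [← hrank, Matroid.eRank_def]
      exact M.eRk_le_encard M.E
    have hS0 : (0 : V4) ∉ hfin.toFinset.image w := by
      rw [Finset.mem_image]
      rintro ⟨e, he, h⟩
      exact h0 e (hfin.mem_toFinset.1 he) h
    refine ⟨hfin.toFinset.image w, hS0, ?_, ?_⟩
    · intro φ hφ
      by_contra! hlt
      -- With at most two elements off the hyperplane, `Y` is a separation of order `Y.ncard`: its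
      -- rank is at most its size and the rest has rank at most 3. It is nonempty because `M` has
      -- rank 4.
      set Y : Set α := {e ∈ M.E | φ (w e) = 1} with hY
      have hYE : Y ⊆ M.E := sep_subset _ _
      have hYc : Y.ncard < 3 := by
        rw [Finset.filter_image, Finset.card_image_of_injOn (hinj.mono (by
          intro x hx
          exact hfin.mem_toFinset.1 (Finset.mem_filter.1 hx).1)),
          ← ncard_coe_finset] at hlt
        rwa [show Y = ↑(hfin.toFinset.filter ((fun x => φ x = 1) ∘ w)) by ext x; simp [hY]]
      have hYe : Y.encard = Y.ncard := (hfin.subset hYE).cast_ncard_eq.symm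
      have hrX : M.eRk (M.E \ Y) < 4 := by
        rw [hw.eRk_eq sdiff_subset]
        have : Submodule.span (ZMod 2) (w '' (M.E \ Y)) ≤ LinearMap.ker φ := by
          rw [Submodule.span_le]
          rintro _ ⟨e, he, rfl⟩
          exact (zmod_two_eq_zero_or_one _).resolve_right fun h => he.2 ⟨he.1, h⟩
        have := (Submodule.finrank_mono this).trans_lt (finrank_ker_lt φ hφ)
        exact_mod_cast this
      have hYpos : 1 ≤ Y.ncard := by
        by_contra! h
        have : Y = ∅ := by
          rw [← encard_eq_zero, hYe]
          exact_mod_cast (by omega)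
        rw [this, sdiff_empty, ← Matroid.eRank_def, hrank] at hrX
        exact lt_irrefl _ hrX
      refine hconn Y.ncard hYpos hYc Y ⟨hYE, hYe.ge, ?_, ?_⟩
      · have h1 := ncard_sdiff_add_ncard_of_subset hYE hfin
        rw [← hfin.cast_ncard_eq] at hE
        have hE' : 4 ≤ M.E.ncard := by exact_mod_cast hE
        rw [← (hfin.subset (sdiff_subset (t := Y))).cast_ncard_eq]
        exact_mod_cast (by omega)
      · have hY1 := M.eRk_le_encard Y
        rw [hYe] at hY1
        rw [hrank, add_comm]
        exact ENat.add_lt_add_of_lt_of_le (ne_top_of_le_ne_top (ENat.natCast_ne_top _) hY1) hrX hY1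
    · rw [isIso_restrict_PG_iff (by
        intro x hx h
        exact hS0 (h ▸ hx))]
      exact ⟨w, hw, hinj, by simp⟩
  · rintro ⟨S, hS0, hS, hiso⟩
    rw [isIso_restrict_PG_iff (by
        intro x hx h
        exact hS0 (h ▸ hx))] at hiso
    obtain ⟨v, hv, hinj, him⟩ := hiso
    have hrank : M.eRank = 4 := by
      rw [Matroid.eRank_def, hv.eRk_eq subset_rfl, him]
      have : Submodule.span (ZMod 2) (S : Set V4) = ⊤ := by
        by_contra hne
        obtain ⟨φ, hφ, hker⟩ := Submodule.exists_le_ker_of_lt_top _ (lt_top_iff_ne_top.2 hne)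
        have h3 := hS φ hφ
        obtain ⟨x, hx⟩ := Finset.card_pos.1 (by omega : 0 < (S.filter (fun x => φ x = 1)).card)
        rw [Finset.mem_filter] at hx
        have := hker (Submodule.subset_span hx.1)
        rw [LinearMap.mem_ker, hx.2] at this
        exact one_ne_zero this
      rw [this]
      simp
    refine ⟨⟨4, v, hv⟩, isConnectedOfOrder_three hv hinj ?_ ?_ hrank, hrank⟩
    · intro e he h
      refine hS0 ?_
      rw [← Finset.mem_coe, ← him, ← h]
      exact ⟨e, he, rfl⟩
    · intro φ hφ
      refine ⟨_, hS φ hφ, fun x hx => ?_⟩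
      rw [Finset.mem_filter] at hx
      exact ⟨hx.2, him ▸ hx.1⟩

/-- Sets of points giving isomorphic matroids are projectively equivalent. -/
theorem exists_linearEquiv_image_eq {α : Type*} {M : Matroid α} [M.Finite] {S T : Set V4}
    (hS : S ⊆ {x | x ≠ 0}) (hT : T ⊆ {x | x ≠ 0}) (h : M ≅ₘ (PG 3).restrict S)
    (h' : M ≅ₘ (PG 3).restrict T) : ∃ g : V4 ≃ₗ[ZMod 2] V4, g '' S = T := by
  obtain ⟨v, hv, -, rfl⟩ := (isIso_restrict_PG_iff hS).1 h
  obtain ⟨w, hw, -, rfl⟩ := (isIso_restrict_PG_iff hT).1 h'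
  obtain ⟨g, hg⟩ := hv.exists_linearEquiv hw
  exact ⟨g, by rw [image_image]; exact image_congr hg⟩

lemma isIso_restrict_image {S : Set V4} (hS : S ⊆ {x | x ≠ 0}) (g : V4 ≃ₗ[ZMod 2] V4) :
    (PG 3).restrict S ≅ₘ (PG 3).restrict (g '' S) := by
  rw [isIso_restrict_PG_iff]
  · refine ⟨g, ?_, g.injective.injOn, rfl⟩
    have h : Represents id ((PG 3).restrict S) := by
      intro I
      rw [Matroid.restrict_indep_iff]
      exact ⟨fun h => ⟨h.2, h.1.2⟩, fun h => ⟨⟨h.1.trans hS, h.2⟩, h.1⟩⟩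
    exact h.map g.toLinearMap g.injective.injOn
  · rintro _ ⟨x, hx, rfl⟩
    simpa using hS hx

/-! ### Points of `PG(3, 2)` as four-bit numbers, sets of points as bit masks -/

/-- The vector of the four lowest binary digits of `n`. -/
def vec (n : ℕ) : V4 := fun i => bif n.testBit i then 1 else 0

/-- The set of the vectors `vec n` for which the bit `n` of `m` is set. -/
def pts (m : ℕ) : Finset V4 := ((Finset.range 16).filter (fun n => m.testBit n)).image vec

lemma vec_xor (a b : ℕ) : vec (a ^^^ b) = vec a + vec b := by
  funext i
  simp only [vec, Nat.testBit_xor, Pi.add_apply]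
  cases a.testBit i <;> cases b.testBit i <;> decide

lemma vec_zero : vec 0 = 0 := by
  funext i
  simp [vec]

lemma vec_injOn : ∀ a < 16, ∀ b < 16, vec a = vec b → a = b := by decide +kernel

lemma exists_vec_eq : ∀ x : V4, ∃ n < 16, vec n = x := by decide +kernel

lemma vec_mem_pts {m n : ℕ} (hn : n < 16) : vec n ∈ pts m ↔ m.testBit n := by
  simp only [pts, Finset.mem_image, Finset.mem_filter, Finset.mem_range]
  constructor
  · rintro ⟨k, ⟨hk, h⟩, hkn⟩
    rwa [← vec_injOn k hk n hn hkn]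
  · exact fun h => ⟨n, ⟨hn, h⟩, rfl⟩

/-- The linear functional with coefficient vector `vec a`. -/
def functional (a : ℕ) : V4 →ₗ[ZMod 2] ZMod 2 := ∑ k, vec a k • LinearMap.proj k

lemma functional_apply (a : ℕ) (x : V4) : functional a x = ∑ k, vec a k * x k := by
  simp [functional, LinearMap.sum_apply]

/-- The parity of the number of common binary digits of `a` and `n`. -/
def parity (a n : ℕ) : Bool :=
  (a &&& n).testBit 0 ^^ (a &&& n).testBit 1 ^^ (a &&& n).testBit 2 ^^ (a &&& n).testBit 3

lemma functional_vec_eq_one {a n : ℕ} :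
    functional a (vec n) = 1 ↔ parity a n = true := by
  rw [functional_apply]
  simp only [vec, parity, Fin.sum_univ_four, Nat.testBit_and, Fin.val_zero, Fin.val_one,
    show ((2 : Fin 4) : ℕ) = 2 from rfl, show ((3 : Fin 4) : ℕ) = 3 from rfl]
  cases a.testBit 0 <;> cases a.testBit 1 <;> cases a.testBit 2 <;> cases a.testBit 3 <;>
  cases n.testBit 0 <;> cases n.testBit 1 <;> cases n.testBit 2 <;> cases n.testBit 3 <;>
  decide

lemma functional_ne_zero : ∀ a < 16, a ≠ 0 → functional a ≠ 0 := by
  intro a ha h0 h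
  have : ∀ a < 16, a ≠ 0 → ∃ n < 16, parity a n = true := by decide +kernel
  obtain ⟨n, -, hn⟩ := this a ha h0
  rw [← functional_vec_eq_one, h] at hn
  exact zero_ne_one hn

lemma exists_functional_eq (φ : V4 →ₗ[ZMod 2] ZMod 2) (hφ : φ ≠ 0) :
    ∃ a < 16, a ≠ 0 ∧ functional a = φ := by
  obtain ⟨a, ha, h⟩ := exists_vec_eq (fun k => φ (Pi.single k 1))
  have hfun : functional a = φ := by
    ext k
    rw [LinearMap.comp_apply, LinearMap.comp_apply, functional_apply, h]
    simp [Pi.single_apply]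
  refine ⟨a, ha, ?_, hfun⟩
  rintro rfl
  exact hφ (by rw [← hfun, functional, vec_zero]; simp)

/-- The number of points outside `pts m` that lie outside the hyperplane of `functional a`. -/
def cocircuitSize (m a : ℕ) : ℕ :=
  ((Finset.range 16).filter (fun n => !m.testBit n && parity a n)).card

lemma card_filter_functional (m a : ℕ) :
    ((pts m)ᶜ.filter (fun x => functional a x = 1)).card = cocircuitSize m a := by
  have : (pts m)ᶜ.filter (fun x => functional a x = 1) =
      ((Finset.range 16).filter (fun n => !m.testBit n && parity a n)).image vec := by
    ext x
    obtain ⟨n, hn, rfl⟩ := exists_vec_eq x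
    simp only [Finset.mem_filter, Finset.mem_compl, vec_mem_pts hn, functional_vec_eq_one,
      Finset.mem_image, Finset.mem_range]
    constructor
    · exact fun h => ⟨n, ⟨hn, by simpa using h⟩, rfl⟩
    · rintro ⟨k, ⟨hk, h⟩, hkn⟩
      rw [← vec_injOn k hk n hn hkn]
      simpa using h
  rw [this, Finset.card_image_of_injOn, cocircuitSize]
  intro x hx y hy
  exact vec_injOn x (Finset.mem_range.1 (Finset.mem_filter.1 hx).1) y
    (Finset.mem_range.1 (Finset.mem_filter.1 hy).1)

lemma hasLargeCocircuits_compl_pts_iff (m : ℕ) :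
    HasLargeCocircuits (pts m)ᶜ ↔ ∀ a < 16, a ≠ 0 → 3 ≤ cocircuitSize m a := by
  constructor
  · intro h a ha h0
    rw [← card_filter_functional]
    exact h _ (functional_ne_zero a ha h0)
  · intro h φ hφ
    obtain ⟨a, ha, h0, rfl⟩ := exists_functional_eq φ hφ
    rw [card_filter_functional]
    exact h a ha h0

/-- Complements are taken in the whole space and so contain the zero vector, which is harmless since
every functional vanishes there. -/
lemma hasLargeCocircuits_erase_zero_iff (S : Finset V4) :
    HasLargeCocircuits (S.erase 0) ↔ HasLargeCocircuits S := by
  refine forall₂_congr fun φ _ => ?_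
  rw [show (S.erase 0).filter (fun x => φ x = 1) = S.filter (fun x => φ x = 1) from ?_]
  ext x
  simp only [Finset.mem_filter, Finset.mem_erase]
  refine ⟨fun h => ⟨h.1.2, h.2⟩, fun h => ⟨⟨?_, h.1⟩, h.2⟩⟩
  rintro rfl
  simp at h

lemma HasLargeCocircuits.image {S : Finset V4} (h : HasLargeCocircuits S)
    (g : V4 ≃ₗ[ZMod 2] V4) : HasLargeCocircuits (S.image g) := by
  intro φ hφ
  have := h (φ ∘ₗ g.toLinearMap) (fun h0 => hφ (by
    ext x
    have := LinearMap.congr_fun h0 (g.symm (Pi.single x 1))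
    simpa using this))
  rw [Finset.filter_image, Finset.card_image_of_injective _ g.injective]
  exact this

/-! ### Linear maps given by numbers -/

/-- The image of `n` under the linear map with columns the hexadecimal digits of `c`. -/
def applyBits (c n : ℕ) : ℕ :=
  (bif n.testBit 0 then c % 16 else 0) ^^^ (bif n.testBit 1 then c / 16 % 16 else 0) ^^^
    (bif n.testBit 2 then c / 256 % 16 else 0) ^^^ (bif n.testBit 3 then c / 4096 % 16 else 0)

/-- The linear map with columns the hexadecimal digits of `c`. -/
def linearOfBits (c : ℕ) : V4 →ₗ[ZMod 2] V4 :=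
  (LinearMap.proj 0).smulRight (vec (c % 16)) + (LinearMap.proj 1).smulRight (vec (c / 16 % 16)) +
    (LinearMap.proj 2).smulRight (vec (c / 256 % 16)) +
    (LinearMap.proj 3).smulRight (vec (c / 4096 % 16))

lemma vec_cond (b : Bool) (k : ℕ) :
    vec (bif b then k else 0) = (bif b then 1 else 0 : ZMod 2) • vec k := by
  cases b
  · simpa using vec_zero
  · simp

lemma linearOfBits_vec (c n : ℕ) : linearOfBits c (vec n) = vec (applyBits c n) := by
  simp only [linearOfBits, applyBits, vec_xor, vec_cond, LinearMap.add_apply,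
    LinearMap.smulRight_apply, LinearMap.proj_apply]
  rfl

/-! ### The classification of the sets of points -/

/-- Representatives of the projective classes of sets whose complement is `3`-connected. -/
def classMask (i : ℕ) : ℕ :=
  [38632, 5864, 21844, 60576, 5736, 5856, 27328, 59528, 5728, 286, 406, 59520, 30, 150, 278,
    14, 22, 6, 2, 0].getD i 0

/-- `stepTable` encodes, for each representative and each further point, the representative of the
enlarged set and a linear map to it. -/
def stepTable : List (List ℕ) :=
  [[0, 0, 0, 0, 0, 0, 0, 0, 0, 0, 0, 0, 0, 0, 0, 0],
   [0, 0, 0, 0, 0, 0, 0, 0, 0, 0, 0, 0, 0, 0, 0, 33825],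
   [0, 38199, 0, 37729, 0, 38449, 0, 38193, 0, 26929, 0, 22833, 0, 63793, 0, 51505],
   [0, 0, 0, 0, 0, 0, 0, 0, 0, 0, 0, 0, 0, 0, 0, 0],
   [0, 111127, 111217, 0, 112417, 0, 0, 99361, 97057, 0, 0, 84001, 0, 82561, 82456, 169265],
   [0, 248119, 248179, 99361, 0, 0, 0, 0, 0, 0, 0, 0, 0, 224305, 224275, 76001],
   [0, 206399, 233971, 229827, 237331, 232467, 0, 0, 260401, 0, 247857, 0, 223521, 0, 0, 215073],
   [0, 0, 0, 0, 207459, 0, 0, 0, 238179, 0, 0, 0, 229953, 0, 0, 0],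
   [0, 381255, 381300, 295969, 374561, 0, 0, 361505, 359201, 0, 0, 346145, 0, 381259, 381364,
    279265],
   [0, 0, 0, 0, 0, 357980, 358085, 358037, 0, 354140, 354245, 354197, 432054, 505811, 505661,
    505837],
   [0, 0, 0, 358037, 0, 358757, 359013, 0, 0, 514931, 514871, 0, 512951, 0, 0, 516023],
   [0, 496915, 496945, 492577, 496465, 492097, 492052, 0, 473425, 469057, 469012, 0, 467332, 0,
    0, 0],
   [0, 0, 0, 0, 0, 530012, 530117, 530069, 623649, 627745, 631841, 635937, 640033, 644129,
    648225, 652321],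
   [0, 0, 0, 530069, 0, 530789, 531045, 0, 689185, 693281, 697377, 701473, 705569, 709665,
    713761, 717857],
   [0, 0, 0, 623649, 0, 623169, 623124, 689185, 0, 600129, 600084, 673825, 598404, 672385,
    672280, 781751],
   [0, 0, 0, 0, 820257, 820513, 820769, 821025, 804897, 808993, 813089, 817185, 837665, 841761,
    845857, 849953],
   [0, 0, 0, 820257, 0, 819777, 819732, 885793, 951329, 955425, 959521, 963617, 967713, 971809,
    975905, 980001],
   [0, 0, 0, 1016865, 1082401, 1082657, 1082913, 1083169, 1067041, 1071137, 1075233, 1079329,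
    1099809, 1103905, 1108001, 1112097],
   [0, 0, 1147937, 1147953, 1147457, 1147713, 1148481, 1148737, 1124417, 1128513, 1140801,
    1144897, 1157185, 1161281, 1173569, 1177665],
   [0, 1213473, 1213458, 1213490, 1212738, 1213250, 1213762, 1214274, 1185858, 1194050,
    1202242, 1210434, 1218626, 1226818, 1235010, 1243202]]

/-- The validity of an entry of `stepTable`. -/
def stepValid (i q : ℕ) : Bool :=
  q == 0 || (classMask i).testBit q ||
  (let c := (stepTable.getD i []).getD q 0
   Nat.blt (c / 65536) 20 &&
   (List.range 16).all (fun n => (n == 0 || applyBits c n != 0) && Nat.blt (applyBits c n) 16 &&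
    (classMask i ||| 1 <<< q).testBit n == (classMask (c / 65536)).testBit (applyBits c n))) ||
  (List.range 16).any (fun a => a != 0 &&
    Nat.blt (cocircuitSize (classMask i ||| 1 <<< q) a) 3)

/-- The finite heart of the classification. A table entry `c` codes the target representative as `c
/ 65536` and, in the lower four hexadecimal digits, the images of the basis vectors. An entry 0
marks a step that needs no map: the added vector is zero or already present, or the enlarged set
leaves some hyperplane with fewer than three points off it. -/
lemma stepValid_all : ∀ i < 20, ∀ q < 16, stepValid i q = true := by decide +kernel

lemma mem_pts_union {m q n : ℕ} (hq : q < 16) (hn : n < 16) :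
    vec n ∈ insert (vec q) (pts m) ↔ (m ||| 1 <<< q).testBit n = true := by
  rw [Finset.mem_insert, vec_mem_pts hn, Nat.testBit_or, Bool.or_eq_true, or_comm]
  refine or_congr_right ⟨fun h => ?_, fun h => ?_⟩
  · rw [vec_injOn n hn q hq h]
    simp
  · rw [Nat.one_shiftLeft, Nat.testBit_two_pow] at h
    rw [of_decide_eq_true h]

lemma insert_vec_pts {m q : ℕ} (hq : q < 16) :
    insert (vec q) (pts m) = pts (m ||| 1 <<< q) := by
  ext x
  obtain ⟨n, hn, rfl⟩ := exists_vec_eq x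
  rw [mem_pts_union hq hn, vec_mem_pts hn]

lemma exists_linearEquiv_insert {i q : ℕ} (hi : i < 20) (hq : q < 16) (h0 : q ≠ 0)
    (hnot : vec q ∉ pts (classMask i))
    (hgood : HasLargeCocircuits (insert (vec q) (pts (classMask i)))ᶜ) :
    ∃ j < 20, ∃ g : V4 ≃ₗ[ZMod 2] V4,
      (insert (vec q) (pts (classMask i))).image g = pts (classMask j) := by
  rw [vec_mem_pts hq] at hnot
  rw [insert_vec_pts hq] at hgood ⊢
  have h := stepValid_all i hi q hq
  simp only [stepValid, Bool.or_eq_true, beq_iff_eq, h0, hnot, false_or,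
    Bool.false_eq_true, List.any_eq_true,
    List.mem_range, Bool.and_eq_true, bne_iff_ne, Nat.blt_eq, List.all_eq_true] at h
  rcases h with ⟨hj, h⟩ | ⟨a, ha, ha0, hlt⟩
  · set c := (stepTable.getD i []).getD q 0
    -- The table check says that no nonzero vector is sent to zero.
    have hinj : Function.Injective (linearOfBits c) := by
      rw [← LinearMap.ker_eq_bot, LinearMap.ker_eq_bot']
      intro x hx
      obtain ⟨n, hn, rfl⟩ := exists_vec_eq x
      rw [linearOfBits_vec, ← vec_zero] at hx
      have h1 := vec_injOn _ (h n hn).1.2 0 (by norm_num) hx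
      rcases (h n hn).1.1 with h2 | h2
      · rw [h2, vec_zero]
      · exact absurd h1 h2
    let g := LinearEquiv.ofInjectiveEndo (linearOfBits c) hinj
    refine ⟨c / 65536, hj, g, ?_⟩
    have hg : ∀ n, g (vec n) = vec (applyBits c n) := linearOfBits_vec c
    have hiff : ∀ n < 16, vec n ∈ pts (classMask i ||| 1 <<< q) ↔
        g (vec n) ∈ pts (classMask (c / 65536)) := by
      intro n hn
      rw [hg, vec_mem_pts hn, vec_mem_pts (h n hn).1.2, (h n hn).2]
    ext y
    rw [Finset.mem_image]
    constructor
    · rintro ⟨x, hx, rfl⟩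
      obtain ⟨n, hn, rfl⟩ := exists_vec_eq x
      exact (hiff n hn).1 hx
    · intro hy
      obtain ⟨n, hn, hny⟩ := exists_vec_eq (g.symm y)
      refine ⟨vec n, (hiff n hn).2 ?_, ?_⟩ <;> rw [hny, g.apply_symm_apply]
      exact hy
  · have := (hasLargeCocircuits_compl_pts_iff _).1 hgood a ha ha0
    omega

/-- Induction on the deleted set: by heredity the smaller set is already equivalent to a
representative, and after transport by `g` the new point is covered by one step of the table. -/
lemma exists_linearEquiv_image_eq_pts (X : Finset V4) (h0 : 0 ∉ X) (hX : HasLargeCocircuits Xᶜ) :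
    ∃ i < 20, ∃ g : V4 ≃ₗ[ZMod 2] V4, X.image g = pts (classMask i) := by
  induction X using Finset.induction_on with
  -- Representative 19 is the empty set.
  | empty => exact ⟨19, by norm_num, LinearEquiv.refl _ _, by decide +kernel⟩
  | insert p X hp ih =>
    obtain ⟨i, hi, g, hg⟩ := ih (fun h => h0 (Finset.mem_insert_of_mem h))
      (hX.mono (Finset.compl_subset_compl.2 (Finset.subset_insert _ _)))
    obtain ⟨q, hq, hqp⟩ := exists_vec_eq (g p)
    have himg : (insert p X).image g = insert (vec q) (pts (classMask i)) := by
      rw [Finset.image_insert, hg, hqp]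
    have hX' := hX.image g
    rw [Finset.compl_eq_univ_sdiff, Finset.image_sdiff _ _ g.injective,
      Finset.image_univ_of_surjective g.surjective, ← Finset.compl_eq_univ_sdiff] at hX'
    obtain ⟨j, hj, f, hf⟩ := exists_linearEquiv_insert hi hq (by
        rintro rfl
        rw [vec_zero, eq_comm, LinearEquiv.map_eq_zero_iff] at hqp
        exact h0 (hqp ▸ Finset.mem_insert_self _ _)) (by
        rw [hqp, ← hg, Finset.mem_image]
        rintro ⟨x, hx, hxp⟩
        exact hp (g.injective hxp ▸ hx)) (himg ▸ hX')
    refine ⟨j, hj, g.trans f, ?_⟩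
    rw [← hf, ← himg, Finset.image_image]
    rfl

/-- A triple determined by the projective class of `X`. -/
def lineInvariant (X : Finset V4) : ℕ × ℕ × Bool :=
  (X.card, ((X ×ˢ X).filter (fun p => p.1 + p.2 ∈ X)).card, decide (∑ x ∈ X, x = 0))

lemma lineInvariant_image (X : Finset V4) (g : V4 ≃ₗ[ZMod 2] V4) :
    lineInvariant (X.image g) = lineInvariant X := by
  have hg := g.injective
  have hmem : ∀ x, g x ∈ X.image g ↔ x ∈ X := fun x => by simp
  have hsum : (∑ x ∈ X, g x = 0) = (∑ x ∈ X, x = 0) := by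
    rw [← map_sum, LinearEquiv.map_eq_zero_iff]
  simp only [lineInvariant]
  rw [Finset.card_image_of_injective _ hg, ← Finset.prodMap_image_product, Finset.filter_image,
    Finset.card_image_of_injective _ (hg.prodMap hg), Finset.sum_image hg.injOn]
  simp only [Prod.map_fst, Prod.map_snd, ← map_add, hmem, hsum]

/-- The second entry is six times the number of lines contained in the set. Together with the size
it separates all classes except the pairs 5 and 6, 10 and 11, and 13 and 14, which are told apart by
whether the points sum to zero. -/
lemma lineInvariant_pts : ∀ i < 20, lineInvariant (pts (classMask i)) =
    [(8, 42, false), (7, 24, false), (7, 42, true), (7, 18, false), (6, 24, false), (6, 12, false),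
      (6, 12, true), (6, 6, false), (5, 12, false), (5, 6, false), (5, 0, false), (5, 0, true),
      (4, 6, false), (4, 0, true), (4, 0, false), (3, 6, true), (3, 0, false), (2, 0, false),
      (1, 0, false), (0, 0, true)].getD i (0, 0, true) := by
  decide +kernel

lemma lineInvariant_pts_injOn : ∀ i < 20, ∀ j < 20,
    lineInvariant (pts (classMask i)) = lineInvariant (pts (classMask j)) → i = j := by
  intro i hi j hj h
  rw [lineInvariant_pts i hi, lineInvariant_pts j hj] at h
  revert i j
  decide +kernel

/-! ### The classification of the matroids -/

/-- The matroid obtained from `PG(3, 2)` by deleting the representative with number `i`. -/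
def classMatroid (i : ℕ) : Matroid V4 := (PG 3).delete (pts (classMask i))

lemma zero_notMem_pts : ∀ i < 20, (0 : V4) ∉ pts (classMask i) := by decide +kernel

lemma coe_subset_PG {S : Finset V4} (h : 0 ∉ S) : (S : Set V4) ⊆ {x | x ≠ 0} :=
  fun _ hx hx0 => h (hx0 ▸ hx)

lemma delete_eq_restrict_erase (X : Finset V4) :
    (PG 3).delete X = (PG 3).restrict ((Xᶜ.erase 0 : Finset V4) : Set V4) := by
  rw [Matroid.delete_eq_restrict]
  congr 1
  ext x
  simp only [Finset.coe_erase, Finset.coe_compl, mem_sdiff, mem_compl_iff, mem_singleton_iff]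
  exact and_comm

lemma zero_notMem_erase (X : Finset V4) : (0 : V4) ∉ Xᶜ.erase 0 := Finset.notMem_erase _ _

lemma image_compl_erase_zero (X : Finset V4) (g : V4 ≃ₗ[ZMod 2] V4) :
    g '' ((Xᶜ.erase 0 : Finset V4) : Set V4) = (((X.image g)ᶜ.erase 0 : Finset V4) : Set V4) := by
  simp only [Finset.coe_erase, Finset.coe_compl, Finset.coe_image]
  rw [image_sdiff g.injective, image_compl_eq g.bijective, image_singleton, map_zero]

lemma isIso_delete_image (X : Finset V4) (g : V4 ≃ₗ[ZMod 2] V4) :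
    (PG 3).delete (X : Set V4) ≅ₘ (PG 3).delete (X.image g : Finset V4) := by
  rw [delete_eq_restrict_erase, delete_eq_restrict_erase, ← image_compl_erase_zero]
  exact isIso_restrict_image (coe_subset_PG (zero_notMem_erase X)) g

lemma hasLargeCocircuits_class :
    ∀ i < 20, HasLargeCocircuits (pts (classMask i))ᶜ := by
  intro i hi
  rw [hasLargeCocircuits_compl_pts_iff]
  revert i
  decide +kernel

section

variable {α β : Type*} {M : Matroid α}

theorem isRankFourBinaryThreeConnected_iff_exists_class [M.Finite] :
    IsRankFourBinaryThreeConnected M ↔ ∃ i < 20, M ≅ₘ classMatroid i := by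
  rw [isRankFourBinaryThreeConnected_iff]
  constructor
  · rintro ⟨S, h0, hS, hM⟩
    have hSX : S = (Sᶜ.erase 0)ᶜ.erase 0 := by
      ext x
      simp only [Finset.mem_erase, Finset.mem_compl, not_and, not_not]
      exact ⟨fun h => ⟨fun hx => h0 (hx ▸ h), fun _ => h⟩, fun h => h.2 h.1⟩
    rw [hSX, hasLargeCocircuits_erase_zero_iff] at hS
    obtain ⟨i, hi, g, hg⟩ := exists_linearEquiv_image_eq_pts _ (zero_notMem_erase S) hS
    refine ⟨i, hi, ?_⟩
    rw [classMatroid, ← hg]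
    refine isIso_trans ?_ (isIso_delete_image _ g)
    rwa [delete_eq_restrict_erase, ← hSX]
  · rintro ⟨i, hi, h⟩
    refine ⟨(pts (classMask i))ᶜ.erase 0, zero_notMem_erase _, ?_, ?_⟩
    · rw [hasLargeCocircuits_erase_zero_iff]
      exact hasLargeCocircuits_class i hi
    · rwa [← delete_eq_restrict_erase]

/-- By unique representability the two sets of remaining points are projectively equivalent, hence
so are the deleted sets, and `lineInvariant` distinguishes these. -/
theorem class_unique [M.Finite] {i j : ℕ} (hi : i < 20) (hj : j < 20) (h : M ≅ₘ classMatroid i)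
    (h' : M ≅ₘ classMatroid j) : i = j := by
  rw [classMatroid, delete_eq_restrict_erase] at h h'
  obtain ⟨g, hg⟩ := exists_linearEquiv_image_eq (coe_subset_PG (zero_notMem_erase _))
    (coe_subset_PG (zero_notMem_erase _)) h h'
  rw [image_compl_erase_zero, Finset.coe_inj] at hg
  refine lineInvariant_pts_injOn i hi j hj ?_
  have h0 : 0 ∉ (pts (classMask i)).image g := by
    rw [Finset.mem_image]
    rintro ⟨x, hx, h⟩
    exact zero_notMem_pts i hi ((LinearEquiv.map_eq_zero_iff g).1 h ▸ hx)
  -- Neither deleted set contains 0, so each is recovered from its complement with 0 erased.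
  have : (pts (classMask i)).image g = pts (classMask j) := by
    have h1 := congrArg (fun S => (insert 0 S)ᶜ.erase 0) hg
    ext x
    by_cases hx : x = 0
    · subst hx
      exact iff_of_false h0 (zero_notMem_pts j hj)
    · have := Finset.ext_iff.1 hg x
      simp only [Finset.mem_erase, ne_eq, hx, not_false_eq_true, true_and, Finset.mem_compl] at this
      exact not_iff_not.1 this
  rw [← this, lineInvariant_image]

/-- The number of elements of `classMatroid i`. -/
def classSize (i : ℕ) : ℕ :=
  [7, 8, 8, 8, 9, 9, 9, 9, 10, 10, 10, 10, 11, 11, 11, 12, 12, 13, 14, 15].getD i 0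

lemma card_class : ∀ i < 20, ((pts (classMask i))ᶜ.erase 0).card = classSize i := by
  decide +kernel

theorem encard_ground_of_class {i : ℕ} (hi : i < 20) (h : M ≅ₘ classMatroid i) :
    M.E.encard = classSize i := by
  rw [classMatroid, delete_eq_restrict_erase] at h
  obtain ⟨e, -⟩ := h
  rw [← card_class i hi, ← encard_coe_eq_coe_finsetCard]
  exact encard_congr e

/-- Any two copies of `N` in PG(3,2) are exchanged by a linear automorphism, which carries the
complement of one to the complement of the other. One explicit copy therefore settles existence and
independence of the choice. -/
lemma isPGComplement_of_restrict {N : Matroid β} {i : ℕ} (hi : i < 20)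
    (hN : N ≅ₘ (PG 3).restrict (pts (classMask i) : Set V4)) (hM : M ≅ₘ classMatroid i) :
    IsPGComplement M N := by
  have hsub := coe_subset_PG (zero_notMem_pts i hi)
  refine ⟨⟨_, hsub, hN⟩, fun X hX hNX => ?_⟩
  lift X to Finset V4 using X.toFinite
  obtain ⟨g, hg⟩ := exists_linearEquiv_image_eq (M := (PG 3).restrict (X : Set V4)) hX hsub
    ((isIso_congr_right hNX).1 (isIso_symm hNX))
    ((isIso_congr_right hN).1 (isIso_symm hNX))
  rw [← Finset.coe_image, Finset.coe_inj] at hg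
  refine isIso_trans hM (isIso_symm ?_)
  rw [classMatroid, ← hg]
  exact isIso_delete_image X g

lemma isPGComplement_iff {N : Matroid β} {i : ℕ} (hi : i < 20)
    (hN : N ≅ₘ (PG 3).restrict (pts (classMask i) : Set V4)) :
    IsPGComplement M N ↔ M ≅ₘ classMatroid i :=
  ⟨fun h => h.2 _ (coe_subset_PG (zero_notMem_pts i hi)) hN, isPGComplement_of_restrict hi hN⟩

lemma isIso_refl (M : Matroid α) : M ≅ₘ M := ⟨Equiv.refl _, fun I => by simp⟩

lemma hasPGComplement_of_restrict {N : Matroid β} {i : ℕ} (hi : i < 20)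
    (hN : N ≅ₘ (PG 3).restrict (pts (classMask i) : Set V4)) : HasPGComplement N :=
  ⟨classMatroid i, isPGComplement_of_restrict hi hN (isIso_refl _)⟩

end

/-! ### Representations of the matroids in the list -/

section

variable {α β ι W W' : Type*} [AddCommGroup W] [Module (ZMod 2) W] [AddCommGroup W']
  [Module (ZMod 2) W']

/-- The values of `k` are, without repetition, the positions of the nonzero bits of `m`. -/
def EnumeratesBits (k : ι → ℕ) (m : ℕ) : Prop :=
  (∀ i j, k i = k j → i = j) ∧ (∀ i, k i < 16 ∧ k i ≠ 0) ∧
    ∀ n < 16, m.testBit n = true ↔ ∃ i, k i = n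

instance [Fintype ι] [DecidableEq ι] (k : ι → ℕ) (m : ℕ) : Decidable (EnumeratesBits k m) := by
  unfold EnumeratesBits
  infer_instance

/-- Reduces the identification of a concrete matroid to a decidable check on the numbers of its
representing vectors; `e` lists the ground set. -/
lemma Represents.isIso_restrict_pts {M : Matroid α} {v : α → V4} (hv : Represents v M)
    (e : ι → α) (he : range e = M.E) (k : ι → ℕ) (hk : ∀ i, v (e i) = vec (k i)) {m : ℕ}
    (hm : EnumeratesBits k m) : M ≅ₘ (PG 3).restrict (pts m : Set V4) := by
  obtain ⟨hinj, hlt, hm⟩ := hm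
  have himg : v '' M.E = (pts m : Set V4) := by
    rw [← he, ← range_comp]
    ext x
    obtain ⟨n, hn, rfl⟩ := exists_vec_eq x
    rw [Finset.mem_coe, vec_mem_pts hn, hm n hn]
    refine exists_congr fun i => ?_
    rw [Function.comp_apply, hk]
    exact ⟨fun h => vec_injOn _ (hlt i).1 n hn h, fun h => h ▸ rfl⟩
  rw [isIso_restrict_PG_iff]
  · refine ⟨v, hv, ?_, himg⟩
    rw [← he]
    rintro _ ⟨i, rfl⟩ _ ⟨j, rfl⟩ h
    rw [hk, hk] at h
    rw [hinj i j (vec_injOn _ (hlt i).1 _ (hlt j).1 h)]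
  · rw [← himg, ← he]
    rintro _ ⟨_, ⟨i, rfl⟩, rfl⟩ h
    rw [hk, ← vec_zero] at h
    exact (hlt i).2 (vec_injOn _ (hlt i).1 0 (by norm_num) h)

lemma Represents.delete {M : Matroid α} {v : α → W} (hv : Represents v M) (D : Set α) :
    Represents v (M.delete D) := by
  intro I
  rw [Matroid.delete_indep_iff, hv I, Matroid.delete_ground, subset_sdiff]
  tauto

/-- The map `p` certifies that the spans of the two families meet only in 0: it fixes one and kills
the other. -/
lemma Represents.sum {M : Matroid α} {N : Matroid β} {v : α → W} {w : β → W}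
    (hv : Represents v M) (hw : Represents w N) (p : W →ₗ[ZMod 2] W)
    (hpv : ∀ a ∈ M.E, p (v a) = v a) (hpw : ∀ b ∈ N.E, p (w b) = 0) :
    Represents (Sum.elim v w) (M.sum N) := by
  classical
  intro I
  rw [Matroid.sum_indep_iff, hv, hw, Matroid.sum_ground]
  have hsub : I ⊆ Sum.inl '' M.E ∪ Sum.inr '' N.E ↔
      Sum.inl ⁻¹' I ⊆ M.E ∧ Sum.inr ⁻¹' I ⊆ N.E := by
    constructor
    · intro h
      exact ⟨fun a ha => by simpa using h ha, fun b hb => by simpa using h hb⟩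
    · rintro ⟨h1, h2⟩ (a | b) hx
      · exact Or.inl ⟨a, h1 hx, rfl⟩
      · exact Or.inr ⟨b, h2 hx, rfl⟩
  rw [hsub]
  constructor
  · rintro ⟨⟨h1, h2⟩, h3, h4⟩
    refine ⟨⟨h1, h3⟩, ?_⟩
    rw [linearIndepOn_iff_sum_ne_zero] at h2 h4 ⊢
    intro J hJ hne h0
    rw [← Finset.toLeft_disjSum_toRight (u := J), Finset.sum_disjSum] at h0
    simp only [Sum.elim_inl, Sum.elim_inr] at h0
    have hJ1 : (J.toLeft : Set α) ⊆ Sum.inl ⁻¹' I := fun a ha => hJ (by simpa using ha)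
    have hJ2 : (J.toRight : Set β) ⊆ Sum.inr ⁻¹' I := fun a ha => hJ (by simpa using ha)
    -- Applying `p` isolates the left part of the vanishing sum, so both parts vanish separately.
    have hp := congrArg p h0
    rw [map_add, map_sum, map_sum, Finset.sum_congr rfl (fun a ha => hpv a (h1 (hJ1 ha))),
      Finset.sum_congr rfl (fun a ha => hpw a (h3 (hJ2 ha))), Finset.sum_const_zero, add_zero,
      map_zero] at hp
    rw [hp, zero_add] at h0
    rcases J.toLeft.eq_empty_or_nonempty with hl | hl
    · rcases J.toRight.eq_empty_or_nonempty with hr | hr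
      · rw [← Finset.toLeft_disjSum_toRight (u := J), hl, hr] at hne
        simp at hne
      · exact h4 _ hJ2 hr h0
    · exact h2 _ hJ1 hl hp
  · rintro ⟨⟨h1, h3⟩, h⟩
    rw [linearIndepOn_iff_sum_ne_zero] at h
    refine ⟨⟨h1, ?_⟩, h3, ?_⟩
    · rw [linearIndepOn_iff_sum_ne_zero]
      intro J hJ hne
      have := h (J.map Function.Embedding.inl) (by
        rw [Finset.coe_map]
        exact image_subset_iff.2 hJ) (hne.map)
      simpa using this
    · rw [linearIndepOn_iff_sum_ne_zero]
      intro J hJ hne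
      have := h (J.map Function.Embedding.inr) (by
        rw [Finset.coe_map]
        exact image_subset_iff.2 hJ) (hne.map)
      simpa using this

lemma represents_U {r n : ℕ} {v : Fin n → W}
    (h : ∀ I : Finset (Fin n), I.card ≤ r ↔ ∀ J ∈ I.powerset, J.Nonempty → ∑ x ∈ J, v x ≠ 0) :
    Represents v (U r n) := by
  intro I
  lift I to Finset (Fin n) using I.toFinite
  rw [linearIndepOn_iff_sum_ne_zero]
  have hI : (U r n).Indep I ↔ (I : Set (Fin n)) ⊆ univ ∧ (I : Set (Fin n)).ncard ≤ r := Iff.rfl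
  rw [hI, ncard_coe_finset, h]
  simp only [Finset.mem_powerset, Finset.coe_subset]
  rfl

/-! #### Cycle matroids -/

/-- The sum of the vectors assigned to the ends of an edge. -/
def edgeSum {V : Type*} (u : V → W) (e : Sym2 V) : W :=
  Sym2.lift ⟨fun a b => u a + u b, fun _ _ => add_comm _ _⟩ e

lemma cycleMatroid_represents_edgeVec {V : Type*} [Finite V] [DecidableEq V]
    (G : SimpleGraph V) : Represents edgeVec (cycleMatroid G) := by
  intro I
  have hI : (cycleMatroid G).Indep I ↔
      I ⊆ G.edgeSet ∧ (SimpleGraph.fromEdgeSet I).IsAcyclic := Iff.rfl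
  rw [hI]
  exact and_congr_right fun h => isAcyclic_iff_linearIndepOn h

/-- An affinely independent assignment of vectors to the vertices represents the cycle matroid. -/
lemma cycleMatroid_represents {V : Type*} [Fintype V] [DecidableEq V] (G : SimpleGraph V)
    (u : V → W) (hu : ∀ c : V → ZMod 2, ∑ a, c a = 0 → ∑ a, c a • u a = 0 → c = 0) :
    Represents (edgeSum u) (cycleMatroid G) := by
  have h := (cycleMatroid_represents_edgeVec G).map (Fintype.linearCombination (ZMod 2) u) ?_
  · convert h using 1
    funext e
    induction e with | h a b =>
    simp [edgeSum, edgeVec_mk, Fintype.linearCombination_apply_single]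
  -- Edge vectors have coordinate sum zero, so injectivity is needed only on that hyperplane; this
  -- is why affine independence of `u` suffices.
  · have hspan : Submodule.span (ZMod 2) (edgeVec '' (cycleMatroid G).E) ≤
        LinearMap.ker (∑ a, LinearMap.proj a : (V → ZMod 2) →ₗ[ZMod 2] ZMod 2) := by
      rw [Submodule.span_le]
      rintro _ ⟨e, -, rfl⟩
      induction e with | h a b =>
      simp only [SetLike.mem_coe, LinearMap.mem_ker, edgeVec_mk, LinearMap.sum_apply,
        LinearMap.proj_apply, Pi.add_apply, Finset.sum_add_distrib, Finset.sum_pi_single',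
        Finset.mem_univ, if_true]
      decide
    intro x hx y hy hxy
    have hmem := hspan (sub_mem hx hy)
    rw [← sub_eq_zero, ← map_sub, Fintype.linearCombination_apply] at hxy
    rw [LinearMap.mem_ker, LinearMap.sum_apply] at hmem
    exact sub_eq_zero.1 (hu _ hmem hxy)

/-! #### Dual matroids -/

lemma Represents.spanning_iff {M : Matroid α} [M.Finite] {v : α → W} (hv : Represents v M)
    {X : Set α} (hX : X ⊆ M.E) :
    M.Spanning X ↔ ∀ e ∈ M.E, v e ∈ Submodule.span (ZMod 2) (v '' X) := by
  rw [Matroid.spanning_iff_eRk_le hX, Matroid.eRank_def, hv.eRk_eq hX, hv.eRk_eq subset_rfl,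
    Nat.cast_le]
  have : FiniteDimensional (ZMod 2) (Submodule.span (ZMod 2) (v '' M.E)) :=
    FiniteDimensional.span_of_finite _ (M.ground_finite.image v)
  have hXfin : FiniteDimensional (ZMod 2) (Submodule.span (ZMod 2) (v '' X)) :=
    FiniteDimensional.span_of_finite _ ((M.ground_finite.subset hX).image v)
  constructor
  · intro h e he
    rw [Submodule.eq_of_le_of_finrank_le (Submodule.span_mono (image_mono hX)) h]
    exact Submodule.subset_span ⟨e, he, rfl⟩
  · intro h
    refine Submodule.finrank_mono (Submodule.span_le.2 ?_)
    rintro _ ⟨e, he, rfl⟩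
    exact h e he

/-- If the linear relations between the vectors `w` are the restrictions of linear functionals to
the vectors `v` representing `M`, then `w` represents the dual of `M`. -/
theorem Represents.dual [Fintype ι] {M : Matroid α} [M.Finite] {v : α → W} {w : α → W'}
    (hv : Represents v M) (e : ι → α) (hinj : Function.Injective e) (he : range e = M.E)
    (h1 : ∀ φ : W →ₗ[ZMod 2] ZMod 2, ∑ i, φ (v (e i)) • w (e i) = 0)
    (h2 : ∀ c : ι → ZMod 2, ∑ i, c i • w (e i) = 0 →
      ∃ φ : W →ₗ[ZMod 2] ZMod 2, ∀ i, φ (v (e i)) = c i) :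
    Represents w M.dual := by
  classical
  intro I
  by_cases hI : I ⊆ M.E
  swap
  · exact iff_of_false (fun h => hI h.subset_ground) (fun h => hI h.1)
  rw [← Matroid.coindep_def, Matroid.coindep_iff_compl_spanning hI, hv.spanning_iff sdiff_subset,
    linearIndepOn_iff_sum_ne_zero, ← not_iff_not]
  push Not
  constructor
  · rintro ⟨x, hx, hnot⟩
    -- If the complement of `I` does not span, some functional vanishes on it but not on `v x`. Its
    -- support lies in `I` and is, by `h1`, a relation among the `w`.
    obtain ⟨φ, hφx, hφ⟩ := Submodule.exists_le_ker_of_notMem hnot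
    have hφ1 : φ (v x) = 1 := (zmod_two_eq_zero_or_one _).resolve_left hφx
    refine fun _ => ⟨(Finset.univ.filter (fun i => φ (v (e i)) = 1)).image e, ?_, ?_, ?_⟩
    · intro y hy
      rw [Finset.mem_coe, Finset.mem_image] at hy
      obtain ⟨i, hi, rfl⟩ := hy
      by_contra hn
      have := hφ (Submodule.subset_span ⟨e i, ⟨he ▸ mem_range_self i, hn⟩, rfl⟩)
      rw [LinearMap.mem_ker, (Finset.mem_filter.1 hi).2] at this
      exact one_ne_zero this
    · rw [← he] at hx
      obtain ⟨i, rfl⟩ := hx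
      exact ⟨e i, Finset.mem_image_of_mem _ (Finset.mem_filter.2 ⟨Finset.mem_univ _, hφ1⟩)⟩
    · rw [Finset.sum_image hinj.injOn, ← sum_smul_eq_sum_filter (fun i => w (e i))]
      exact h1 φ
  · intro h
    obtain ⟨J, hJ, ⟨x, hx⟩, h0⟩ := h hI
    have hJe : J = (Finset.univ.filter (fun i => (if e i ∈ J then 1 else 0 : ZMod 2) = 1)).image e
        := by
      ext y
      simp only [Finset.mem_image, Finset.mem_filter, Finset.mem_univ, true_and]
      constructor
      · intro hy
        obtain ⟨i, rfl⟩ : y ∈ range e := he ▸ hI (hJ hy)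
        exact ⟨i, by simp [hy], rfl⟩
      · rintro ⟨i, hi, rfl⟩
        by_contra hn
        simp [hn] at hi
    -- Conversely, a relation supported in `I` comes from a functional that is zero on the
    -- complement of `I` and nonzero at `x`, so the complement does not span.
    have hsum : ∑ i, (if e i ∈ J then 1 else 0 : ZMod 2) • w (e i) = 0 := by
      rw [sum_smul_eq_sum_filter (fun i => w (e i)), ← Finset.sum_image hinj.injOn, ← hJe, h0]
    obtain ⟨φ, hφ⟩ := h2 _ hsum
    have hφ' : ∀ y ∈ M.E, φ (v y) = if y ∈ J then 1 else 0 := by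
      intro y hy
      rw [← he] at hy
      obtain ⟨i, rfl⟩ := hy
      exact hφ i
    refine ⟨x, hI (hJ hx), fun hspan => ?_⟩
    have : Submodule.span (ZMod 2) (v '' (M.E \ I)) ≤ LinearMap.ker φ := by
      rw [Submodule.span_le]
      rintro _ ⟨y, hy, rfl⟩
      rw [SetLike.mem_coe, LinearMap.mem_ker, hφ' y hy.1,
        if_neg fun h => hy.2 (hJ (Finset.mem_coe.2 h))]
    have := this hspan
    rw [LinearMap.mem_ker, hφ' x (hI (hJ hx)), if_pos hx] at this
    exact one_ne_zero this

end

/-- The mask 65534 has exactly the bits 1 to 15, one for each point of PG(3,2). -/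
lemma compl_pts_erase_zero :
    ∀ i < 20, (pts (classMask i))ᶜ.erase 0 = pts (65534 ^^^ classMask i) := by
  decide +kernel

lemma classMatroid_eq_restrict {i : ℕ} (hi : i < 20) :
    classMatroid i = (PG 3).restrict (pts (65534 ^^^ classMask i) : Set V4) := by
  rw [← compl_pts_erase_zero i hi, classMatroid, delete_eq_restrict_erase]

lemma Represents.isIso_classMatroid {α ι : Type*} {M : Matroid α} {v : α → V4}
    (hv : Represents v M) {i : ℕ} (hi : i < 20) (e : ι → α) (he : range e = M.E) (k : ι → ℕ)
    (hk : ∀ i, v (e i) = vec (k i)) (hm : EnumeratesBits k (65534 ^^^ classMask i)) :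
    M ≅ₘ classMatroid i := by
  rw [classMatroid_eq_restrict hi]
  exact hv.isIso_restrict_pts e he k hk hm

/-! #### The spikes, `P₉` and the geometries -/

/-- The numbers of the columns of the matrix representing `Z₄`. -/
def spikeNumber : Fin 4 ⊕ (Fin 4 ⊕ Unit) → ℕ :=
  Sum.elim ![1, 2, 4, 8] (Sum.elim ![14, 13, 11, 7] (fun _ => 15))

lemma Z_four_represents : Represents (fun x => vec (spikeNumber x)) (Z 4) := by
  refine (vectorMatroid_represents _ univ).congr ?_
  rintro x -
  revert x
  decide +kernel

lemma isIso_Z_four : Z 4 ≅ₘ classMatroid 4 :=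
  Z_four_represents.isIso_classMatroid (by norm_num) id (by rw [range_id]; rfl) _ (fun _ => rfl)
    (by decide +kernel)

lemma isIso_S8 : S8 ≅ₘ classMatroid 1 := by
  refine (Z_four_represents.delete {Sum.inr (Sum.inl 3)}).isIso_classMatroid (by norm_num)
    (fun x : {x : Fin 4 ⊕ (Fin 4 ⊕ Unit) // x ≠ Sum.inr (Sum.inl 3)} => x.1) ?_
    (fun x => spikeNumber x.1) (fun _ => rfl) (by decide +kernel)
  rw [Subtype.range_coe_subtype, Matroid.delete_ground]
  ext x
  exact ⟨fun h => ⟨trivial, h⟩, fun h => h.2⟩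

lemma isIso_P9 : P9 ≅ₘ classMatroid 5 :=
  (vectorMatroid_represents P9Matrix.col univ).isIso_classMatroid (by norm_num) id
    (by rw [range_id]; rfl) ![1, 2, 4, 8, 14, 13, 11, 15, 3] (by decide +kernel)
    (by decide +kernel)

lemma isIso_AG32 : AG32 ≅ₘ classMatroid 2 := by
  have h : AG32 = classMatroid 2 := by
    rw [AG32, classMatroid, Matroid.delete_eq_restrict, Matroid.delete_eq_restrict]
    congr 1
    ext x
    have : ∀ x : V4, x ≠ 0 → (x 0 = 0 ↔ x ∈ pts (classMask 2)) := by decide +kernel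
    exact and_congr_right fun hx => not_congr (this x hx)
  rw [h]
  exact isIso_refl _

lemma isIso_PG_three : PG 3 ≅ₘ classMatroid 19 := by
  have h : classMatroid 19 = PG 3 := by
    rw [classMatroid, show pts (classMask 19) = ∅ by decide +kernel, Finset.coe_empty,
      Matroid.delete_empty]
  rw [h]
  exact isIso_refl _

/-! #### Uniform matroids and their sums -/

lemma isIso_U {r n : ℕ} (k : Fin n → ℕ) {i : ℕ}
    (h : ∀ I : Finset (Fin n), I.card ≤ r ↔
      ∀ J ∈ I.powerset, J.Nonempty → ∑ x ∈ J, vec (k x) ≠ 0)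
    (hm : EnumeratesBits k (classMask i)) :
    U r n ≅ₘ (PG 3).restrict (pts (classMask i) : Set V4) :=
  (represents_U h).isIso_restrict_pts id (by rw [range_id]; rfl) k (fun _ => rfl) hm

lemma isIso_U_sum_U {r n s m : ℕ} (k : Fin n → ℕ) (l : Fin m → ℕ) (p : ℕ) {i : ℕ}
    (hk : ∀ I : Finset (Fin n), I.card ≤ r ↔
      ∀ J ∈ I.powerset, J.Nonempty → ∑ x ∈ J, vec (k x) ≠ 0)
    (hl : ∀ I : Finset (Fin m), I.card ≤ s ↔
      ∀ J ∈ I.powerset, J.Nonempty → ∑ x ∈ J, vec (l x) ≠ 0)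
    (hpk : ∀ x, applyBits p (k x) = k x) (hpl : ∀ x, applyBits p (l x) = 0)
    (hm : EnumeratesBits (Sum.elim k l) (classMask i)) :
    (U r n).sum (U s m) ≅ₘ (PG 3).restrict (pts (classMask i) : Set V4) := by
  refine ((represents_U hk).sum (represents_U hl) (linearOfBits p) ?_ ?_).isIso_restrict_pts id
    ?_ (Sum.elim k l) ?_ hm
  · intro x _
    rw [linearOfBits_vec, hpk]
  · intro x _
    rw [linearOfBits_vec, hpl, vec_zero]
  · rw [range_id, Matroid.sum_ground]
    ext (x | x)
    · exact iff_of_true trivial (Or.inl ⟨x, trivial, rfl⟩)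
    · exact iff_of_true trivial (Or.inr ⟨x, trivial, rfl⟩)
  · rintro (x | x) <;> rfl

lemma isIso_U_two_three_sum_U_two_three :
    (U 2 3).sum (U 2 3) ≅ₘ (PG 3).restrict (pts (classMask 6) : Set V4) :=
  -- In hexadecimal 28086 is 6DB6: the projection onto the span of the first line along the span of
  -- the second.
  isIso_U_sum_U ![6, 11, 13] ![7, 9, 14] 28086 (by decide +kernel) (by decide +kernel)
    (by decide +kernel) (by decide +kernel) (by decide +kernel)

lemma isIso_U_two_three_sum_U_two_two :
    (U 2 3).sum (U 2 2) ≅ₘ (PG 3).restrict (pts (classMask 9) : Set V4) :=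
  -- In hexadecimal 33 is 0021: the projection onto the first two coordinates.
  isIso_U_sum_U ![1, 2, 3] ![4, 8] 33 (by decide +kernel) (by decide +kernel)
    (by decide +kernel) (by decide +kernel) (by decide +kernel)

lemma isIso_U_three_four_sum_U_one_one :
    (U 3 4).sum (U 1 1) ≅ₘ (PG 3).restrict (pts (classMask 10) : Set V4) :=
  -- In hexadecimal 1057 is 0421: the projection onto the first three coordinates.
  isIso_U_sum_U ![1, 2, 4, 7] ![8] 1057 (by decide +kernel) (by decide +kernel)
    (by decide +kernel) (by decide +kernel) (by decide +kernel)

lemma isIso_U_two_three_sum_U_one_one :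
    (U 2 3).sum (U 1 1) ≅ₘ (PG 3).restrict (pts (classMask 12) : Set V4) :=
  isIso_U_sum_U ![1, 2, 3] ![4] 33 (by decide +kernel) (by decide +kernel)
    (by decide +kernel) (by decide +kernel) (by decide +kernel)

lemma isIso_U_four_five : U 4 5 ≅ₘ (PG 3).restrict (pts (classMask 11) : Set V4) :=
  isIso_U ![7, 11, 13, 14, 15] (by decide +kernel) (by decide +kernel)

lemma isIso_U_three_four : U 3 4 ≅ₘ (PG 3).restrict (pts (classMask 13) : Set V4) :=
  isIso_U ![1, 2, 4, 7] (by decide +kernel) (by decide +kernel)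

lemma isIso_U_four_four : U 4 4 ≅ₘ (PG 3).restrict (pts (classMask 14) : Set V4) :=
  isIso_U ![1, 2, 4, 8] (by decide +kernel) (by decide +kernel)

lemma isIso_U_two_three : U 2 3 ≅ₘ (PG 3).restrict (pts (classMask 15) : Set V4) :=
  isIso_U ![1, 2, 3] (by decide +kernel) (by decide +kernel)

lemma isIso_U_three_three : U 3 3 ≅ₘ (PG 3).restrict (pts (classMask 16) : Set V4) :=
  isIso_U ![1, 2, 4] (by decide +kernel) (by decide +kernel)

lemma isIso_U_two_two : U 2 2 ≅ₘ (PG 3).restrict (pts (classMask 17) : Set V4) :=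
  isIso_U ![1, 2] (by decide +kernel) (by decide +kernel)

lemma isIso_U_one_one : U 1 1 ≅ₘ (PG 3).restrict (pts (classMask 18) : Set V4) :=
  isIso_U ![1] (by decide +kernel) (by decide +kernel)

/-! #### The parallel connection -/

lemma PU23U34_indep_iff (I : Finset (Fin 6)) :
    PU23U34.Indep I ↔ (I ∩ {0, 1, 2}).card ≤ 2 ∧ (I ∩ {2, 3, 4, 5}).card ≤ 3 ∧
      ((insert 2 (I ∩ {0, 1, 2})).card ≤ 2 ∨ (insert 2 (I ∩ {2, 3, 4, 5})).card ≤ 3) := by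
  have hp : (uniformOn 2 ({0, 1, 2} : Set (Fin 6))).E ∩
      (uniformOn 3 ({2, 3, 4, 5} : Set (Fin 6))).E = {2} := by
    change ({0, 1, 2} : Set (Fin 6)) ∩ {2, 3, 4, 5} = {2}
    ext x
    simp only [mem_inter_iff, mem_insert_iff, mem_singleton_iff]
    revert x
    decide
  have h : PU23U34.Indep I ↔ _ := parallel_indep_iff hp
  have hE : ∀ x : Fin 6, x ∈ ({0, 1, 2} : Set (Fin 6)) ∪ {2, 3, 4, 5} := by
    simp only [mem_union, mem_insert_iff, mem_singleton_iff]
    decide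
  have hu : ∀ (r : ℕ) (A J : Finset (Fin 6)),
      (uniformOn r (A : Set (Fin 6))).Indep (J : Set (Fin 6)) ↔ J ⊆ A ∧ J.card ≤ r := by
    intro r A J
    rw [← Finset.coe_subset, ← ncard_coe_finset]
    rfl
  have e1 : ({0, 1, 2} : Set (Fin 6)) = (({0, 1, 2} : Finset (Fin 6)) : Set (Fin 6)) := by simp
  have e2 : ({2, 3, 4, 5} : Set (Fin 6)) = (({2, 3, 4, 5} : Finset (Fin 6)) : Set (Fin 6)) := by
    simp
  rw [h]
  refine (and_iff_right fun x _ => hE x).trans ?_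
  change (uniformOn 2 ({0, 1, 2} : Set (Fin 6))).Indep (↑I ∩ {0, 1, 2}) ∧
    (uniformOn 3 ({2, 3, 4, 5} : Set (Fin 6))).Indep (↑I ∩ {2, 3, 4, 5}) ∧
    ((uniformOn 2 ({0, 1, 2} : Set (Fin 6))).Indep (insert 2 (↑I ∩ {0, 1, 2})) ∨
    (uniformOn 3 ({2, 3, 4, 5} : Set (Fin 6))).Indep (insert 2 (↑I ∩ {2, 3, 4, 5}))) ↔ _
  rw [e1, e2, ← Finset.coe_inter, ← Finset.coe_inter, ← Finset.coe_insert, ← Finset.coe_insert,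
    hu, hu, hu, hu, and_iff_right Finset.inter_subset_right,
    and_iff_right Finset.inter_subset_right,
    and_iff_right (Finset.insert_subset (by decide) Finset.inter_subset_right),
    and_iff_right (Finset.insert_subset (by decide) Finset.inter_subset_right)]

/-- The points 13, 14, 3 form a line and 3, 7, 11, 15 a four-point circuit spanning a plane that
meets this line only in 3, the basepoint. -/
lemma PU23U34_represents :
    Represents (fun x => vec (![13, 14, 3, 7, 11, 15] x)) PU23U34 := by
  have hE : PU23U34.E = univ := by
    have : ∀ x : Fin 6, x ∈ ({0, 1, 2} : Set (Fin 6)) ∪ {2, 3, 4, 5} := by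
      simp only [mem_union, mem_insert_iff, mem_singleton_iff]
      decide
    exact eq_univ_of_forall this
  have key : ∀ I : Finset (Fin 6), ((I ∩ {0, 1, 2}).card ≤ 2 ∧ (I ∩ {2, 3, 4, 5}).card ≤ 3 ∧
      ((insert 2 (I ∩ {0, 1, 2})).card ≤ 2 ∨ (insert 2 (I ∩ {2, 3, 4, 5})).card ≤ 3)) ↔
      ∀ J ∈ I.powerset, J.Nonempty → ∑ x ∈ J, vec (![13, 14, 3, 7, 11, 15] x) ≠ 0 := by
    decide +kernel
  intro I
  lift I to Finset (Fin 6) using I.toFinite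
  rw [PU23U34_indep_iff, key, hE, linearIndepOn_iff_sum_ne_zero,
    and_iff_right (subset_univ _)]
  simp only [Finset.mem_powerset, Finset.coe_subset]

lemma isIso_PU23U34 : PU23U34 ≅ₘ (PG 3).restrict (pts (classMask 7) : Set V4) := by
  refine PU23U34_represents.isIso_restrict_pts id ?_ ![13, 14, 3, 7, 11, 15] (fun _ => rfl)
    (by decide +kernel)
  have : ∀ x : Fin 6, x ∈ ({0, 1, 2} : Set (Fin 6)) ∪ {2, 3, 4, 5} := by
    simp only [mem_union, mem_insert_iff, mem_singleton_iff]
    decide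
  rw [range_id]
  exact (eq_univ_of_forall this).symm

/-! #### Graphic matroids -/

lemma range_eq_edgeSet {V ι : Type*} {G : SimpleGraph V} {e : ι → Sym2 V}
    (h : ∀ a b, G.Adj a b ↔ ∃ i, e i = s(a, b)) : range e = G.edgeSet := by
  ext x
  induction x with | h a b =>
  exact (h a b).symm

lemma completeMinusEdge_adj {n : ℕ} (a b : Fin (n + 2)) :
    (completeMinusEdge n).Adj a b ↔ a ≠ b ∧ s(a, b) ≠ s(0, 1) := by
  simp [completeMinusEdge, SimpleGraph.deleteEdges_adj]

/-- The numbers of the standard basis vectors. -/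
def basisNumber : Fin 4 → ℕ := ![1, 2, 4, 8]

/-- The number of the zero vector and the numbers of the standard basis vectors. -/
def affineNumber : Fin 5 → ℕ := ![1, 2, 4, 8, 0]

/-- With the basis vectors as vertices, the edges become the vectors of weight two. -/
lemma cycleMatroid_represents_fin_four (G : SimpleGraph (Fin 4)) :
    Represents (edgeSum (fun a => vec (basisNumber a))) (cycleMatroid G) :=
  cycleMatroid_represents G _ (by decide +kernel)

/-- Adding the zero vector as a fifth vertex keeps affine independence; the edges become the vectors
of weight one or two. -/
lemma cycleMatroid_represents_fin_five (G : SimpleGraph (Fin 5)) :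
    Represents (edgeSum (fun a => vec (affineNumber a))) (cycleMatroid G) :=
  cycleMatroid_represents G _ (by decide +kernel)

lemma isIso_K_four :
    cycleMatroid (⊤ : SimpleGraph (Fin 4)) ≅ₘ (PG 3).restrict (pts (classMask 4) : Set V4) :=
  (cycleMatroid_represents_fin_four ⊤).isIso_restrict_pts
    ![s(0, 1), s(0, 2), s(1, 2), s(0, 3), s(1, 3), s(2, 3)]
    (range_eq_edgeSet (by simp only [SimpleGraph.top_adj]; decide +kernel))
    ![3, 5, 6, 9, 10, 12] (by decide +kernel) (by decide +kernel)

/-- The edges of `K₄` without one edge. -/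
def edgesKFourMinus : Fin 5 → Sym2 (Fin 4) := ![s(0, 2), s(1, 2), s(0, 3), s(1, 3), s(2, 3)]

lemma range_edgesKFourMinus : range edgesKFourMinus = (completeMinusEdge 2).edgeSet :=
  range_eq_edgeSet (by simp only [completeMinusEdge_adj]; decide +kernel)

lemma isIso_K_four_minus :
    cycleMatroid (completeMinusEdge 2) ≅ₘ (PG 3).restrict (pts (classMask 8) : Set V4) :=
  (cycleMatroid_represents_fin_four _).isIso_restrict_pts edgesKFourMinus range_edgesKFourMinus
    ![5, 6, 9, 10, 12] (by decide +kernel) (by decide +kernel)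

lemma isIso_K_four_minus_sum_U_one_one :
    (cycleMatroid (completeMinusEdge 2)).sum (U 1 1) ≅ₘ
      (PG 3).restrict (pts (classMask 5) : Set V4) := by
  have hU : Represents (fun _ => vec 7) (U 1 1) := represents_U (by decide +kernel)
  -- In hexadecimal 62294 is F356: the projection onto the vectors of even weight, which contain all
  -- edges, along the vector 7.
  refine ((cycleMatroid_represents_fin_four _).sum hU (linearOfBits 62294) ?_
    ?_).isIso_restrict_pts (Sum.map edgesKFourMinus id) ?_
    (Sum.elim ![5, 6, 9, 10, 12] (fun _ => 7)) ?_ (by decide +kernel)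
  · intro x hx
    obtain ⟨i, rfl⟩ : x ∈ range edgesKFourMinus := range_edgesKFourMinus ▸ hx
    clear hx
    revert i
    decide +kernel
  · intro _ _
    decide +kernel
  · rw [Matroid.sum_ground]
    have h : (cycleMatroid (completeMinusEdge 2)).E = range edgesKFourMinus :=
      range_edgesKFourMinus.symm
    rw [h]
    ext (x | x)
    · simp
    · exact iff_of_true ⟨Sum.inr x, rfl⟩ (Or.inr ⟨x, trivial, rfl⟩)
  · decide +kernel

lemma isIso_K_five : cycleMatroid (⊤ : SimpleGraph (Fin 5)) ≅ₘ classMatroid 11 :=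
  (cycleMatroid_represents_fin_five ⊤).isIso_classMatroid (by norm_num)
    ![s(0, 1), s(0, 2), s(1, 2), s(0, 3), s(1, 3), s(2, 3), s(0, 4), s(1, 4), s(2, 4), s(3, 4)]
    (range_eq_edgeSet (by simp only [SimpleGraph.top_adj]; decide +kernel))
    ![3, 5, 6, 9, 10, 12, 1, 2, 4, 8] (by decide +kernel) (by decide +kernel)

lemma isIso_K_five_minus : cycleMatroid (completeMinusEdge 3) ≅ₘ classMatroid 7 :=
  (cycleMatroid_represents_fin_five _).isIso_classMatroid (by norm_num)
    ![s(0, 2), s(1, 2), s(0, 3), s(1, 3), s(2, 3), s(0, 4), s(1, 4), s(2, 4), s(3, 4)]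
    (range_eq_edgeSet (by simp only [completeMinusEdge_adj]; decide +kernel))
    ![5, 6, 9, 10, 12, 1, 2, 4, 8] (by decide +kernel) (by decide +kernel)

lemma wheelGraph_adj {n : ℕ} (a b : Option (Fin n)) :
    (wheelGraph n).Adj a b ↔ (a ≠ b ∧ (a = none ∨ b = none)) ∨
      ∃ i j, (SimpleGraph.cycleGraph n).Adj i j ∧ some i = a ∧ some j = b := by
  rw [wheelGraph, SimpleGraph.sup_adj, SimpleGraph.starGraph_adj, SimpleGraph.map_adj]
  rfl

lemma isIso_wheel : cycleMatroid (wheelGraph 4) ≅ₘ classMatroid 3 := by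
  -- The hub is placed at 0, so the spokes are the basis vectors.
  have hrep : Represents (edgeSum (fun a : Option (Fin 4) => vec (a.elim 0 basisNumber)))
      (cycleMatroid (wheelGraph 4)) := cycleMatroid_represents _ _ (by decide +kernel)
  refine hrep.isIso_classMatroid (by norm_num)
    ![s(none, some 0), s(none, some 1), s(none, some 2), s(none, some 3), s(some 0, some 1),
      s(some 1, some 2), s(some 2, some 3), s(some 0, some 3)] (range_eq_edgeSet ?_)
    ![1, 2, 4, 8, 3, 6, 12, 9] (by decide +kernel) (by decide +kernel)
  simp only [wheelGraph_adj]
  decide +kernel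

/-! #### Dual matroids -/

/-- The nonzero vectors of the three-dimensional space. -/
def fanoPoint (i : Fin 7) : Fin 3 → ZMod 2 := fun k => bif (i.1 + 1).testBit k then 1 else 0

/-- The numbers of vectors representing the dual of the Fano matroid. -/
def fanoDualNumber : Fin 7 → ℕ := ![11, 13, 1, 14, 2, 4, 8]

/-- Vectors representing the dual of the Fano matroid. -/
def fanoDualVector (x : Fin 3 → ZMod 2) : V4 :=
  ∑ i, if fanoPoint i = x then vec (fanoDualNumber i) else 0

lemma linearMap_eq_sum {ι : Type*} [Fintype ι] [DecidableEq ι] (φ : (ι → ZMod 2) →ₗ[ZMod 2] ZMod 2)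
    (x : ι → ZMod 2) : φ x = ∑ k, x k * φ (Pi.single k 1) := by
  rw [φ.pi_apply_eq_sum_univ x]
  refine Finset.sum_congr rfl fun k _ => ?_
  rw [smul_eq_mul]
  congr 2
  funext j
  simp [Pi.single_apply, eq_comm]

lemma fanoDualVector_fanoPoint (i : Fin 7) :
    fanoDualVector (fanoPoint i) = vec (fanoDualNumber i) := by
  revert i
  decide +kernel

lemma range_fanoPoint : range fanoPoint = F7.E := by
  have : ∀ x : Fin 3 → ZMod 2, (∃ i, fanoPoint i = x) ↔ x ≠ 0 := by decide +kernel
  ext x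
  exact this x

/-- In the standard form of a dual representation, the four points of weight at least two receive
the basis vectors, and each unit vector receives the sum over those of the four whose support
contains it. -/
lemma F7_dual_represents : Represents fanoDualVector F7.dual := by
  refine (vectorMatroid_represents id {x : Fin 3 → ZMod 2 | x ≠ 0}).dual fanoPoint
    (by unfold Function.Injective; decide +kernel) range_fanoPoint ?_ ?_
  · intro φ
    have h : ∀ b : Fin 3 → ZMod 2,
        ∑ i, (∑ k, fanoPoint i k * b k) • vec (fanoDualNumber i) = 0 := by decide +kernel
    simp only [id, fanoDualVector_fanoPoint, linearMap_eq_sum φ (fanoPoint _)]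
    exact h _
  · intro c hc
    -- The indices 0, 1, 3 are the unit vectors, at which a functional can be prescribed freely.
    have h : ∀ c : Fin 7 → ZMod 2, ∑ i, c i • vec (fanoDualNumber i) = 0 →
        ∀ i, ∑ k, ![c 0, c 1, c 3] k * fanoPoint i k = c i := by decide +kernel
    simp only [fanoDualVector_fanoPoint] at hc
    refine ⟨∑ k, ![c 0, c 1, c 3] k • LinearMap.proj k, fun i => ?_⟩
    rw [← h c hc i]
    simp [LinearMap.sum_apply]

lemma isIso_F7_dual : F7.dual ≅ₘ classMatroid 0 :=
  F7_dual_represents.isIso_classMatroid (by norm_num) fanoPoint range_fanoPoint fanoDualNumber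
    fanoDualVector_fanoPoint (by decide +kernel)

/-- The edges of `K₃,₃`. -/
def edgesKThreeThree (i : Fin 3 × Fin 3) : Sym2 (Fin 3 ⊕ Fin 3) := s(Sum.inl i.1, Sum.inr i.2)

/-- The numbers of vectors representing the bond matroid of `K₃,₃`. -/
def bondNumber (i : Fin 3 × Fin 3) : ℕ := ![![15, 5, 10], ![3, 1, 2], ![12, 4, 8]] i.1 i.2

/-- Vectors representing the bond matroid of `K₃,₃`. -/
def bondVector (x : Sym2 (Fin 3 ⊕ Fin 3)) : V4 :=
  ∑ i, if edgesKThreeThree i = x then vec (bondNumber i) else 0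

lemma bondVector_edges (i : Fin 3 × Fin 3) :
    bondVector (edgesKThreeThree i) = vec (bondNumber i) := by
  revert i
  decide +kernel

lemma range_edgesKThreeThree :
    range edgesKThreeThree = (completeBipartiteGraph (Fin 3) (Fin 3)).edgeSet := by
  refine range_eq_edgeSet ?_
  simp only [completeBipartiteGraph_adj]
  decide +kernel

/-- The rows and columns of the array of `bondNumber` sum to zero, so every vertex star is a
relation; the relations are exactly the edge cuts. -/
lemma K_three_three_dual_represents :
    Represents bondVector (cycleMatroid (completeBipartiteGraph (Fin 3) (Fin 3))).dual := by
  refine (cycleMatroid_represents_edgeVec (completeBipartiteGraph (Fin 3) (Fin 3))).dual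
    edgesKThreeThree (by unfold Function.Injective; decide +kernel) range_edgesKThreeThree ?_ ?_
  · intro φ
    have h : ∀ b : Fin 3 ⊕ Fin 3 → ZMod 2,
        ∑ i : Fin 3 × Fin 3, (b (Sum.inl i.1) + b (Sum.inr i.2)) • vec (bondNumber i) = 0 := by
      decide +kernel
    simp only [bondVector_edges]
    rw [← h (fun a => φ (Pi.single a 1))]
    simp only [edgesKThreeThree, edgeVec_mk, map_add]
  · intro c hc
    -- Every relation splits as a function of the row plus a function of the column, which gives the
    -- vertex labelling `b` defining the cut.
    have h : ∀ c : Fin 3 → Fin 3 → ZMod 2,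
        ∑ i : Fin 3 × Fin 3, c i.1 i.2 • vec (bondNumber i) = 0 →
        ∀ i : Fin 3 × Fin 3, c i.1 0 + (c 0 i.2 + c 0 0) = c i.1 i.2 := by decide +kernel
    simp only [bondVector_edges] at hc
    let b : Fin 3 ⊕ Fin 3 → ZMod 2 := Sum.elim (fun i => c (i, 0)) (fun j => c (0, j) + c (0, 0))
    refine ⟨∑ a, b a • LinearMap.proj a, fun i => ?_⟩
    rw [← h (fun i j => c (i, j)) hc i]
    simp [LinearMap.sum_apply, edgesKThreeThree, edgeVec_mk, b, Pi.single_apply]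

lemma isIso_K_three_three_dual :
    (cycleMatroid (completeBipartiteGraph (Fin 3) (Fin 3))).dual ≅ₘ classMatroid 6 :=
  K_three_three_dual_represents.isIso_classMatroid (by norm_num) edgesKThreeThree
    range_edgesKThreeThree bondNumber bondVector_edges (by decide +kernel)

/-- Distinct entries of a list belong to distinct classes, so existence already gives uniqueness;
the size condition selects exactly the classes in the list because it depends only on the class. -/
lemma isRankFour_and_iff_existsUnique {α : Type*} {M : Matroid α} [M.Finite] {n : ℕ}
    {p : Fin n → Prop} {c : Prop} (f : Fin n → ℕ) (hf : ∀ x y, f x = f y → x = y)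
    (hlt : ∀ x, f x < 20) (q : ℕ → Prop) (hc : ∀ s : ℕ, M.E.encard = s → (c ↔ q s))
    (hq : ∀ i < 20, q (classSize i) ↔ ∃ x, f x = i)
    (hp : ∀ x, p x ↔ M ≅ₘ classMatroid (f x)) :
    (IsRankFourBinaryThreeConnected M ∧ c) ↔ ∃! x, p x := by
  rw [isRankFourBinaryThreeConnected_iff_exists_class]
  constructor
  · rintro ⟨⟨i, hi, h⟩, hM⟩
    obtain ⟨x, rfl⟩ := (hq i hi).1 ((hc _ (encard_ground_of_class hi h)).1 hM)
    refine ⟨x, (hp x).2 h, fun y hy => hf _ _ ?_⟩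
    exact class_unique (hlt y) hi ((hp y).1 hy) h
  · rintro ⟨x, hx, -⟩
    have h := (hp x).1 hx
    exact ⟨⟨_, hlt x, h⟩,
      (hc _ (encard_ground_of_class (hlt x) h)).2 ((hq _ (hlt x)).2 ⟨x, rfl⟩)⟩

end BinaryMatroids

theorem mainTheorem3 {α : Type*} (M : Matroid α) [M.Finite] :
    -- (i) up to 8 elements
    ((IsRankFourBinaryThreeConnected M ∧ M.E.encard ≤ 8) ↔
      ∃! i : Fin 4, (![
        M ≅ₘ F7.dual,
        M ≅ₘ S8,
        M ≅ₘ AG32,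
        M ≅ₘ cycleMatroid (wheelGraph 4)] : Fin 4 → Prop) i) ∧
    -- (ii) 9 elements
    ((IsRankFourBinaryThreeConnected M ∧ M.E.encard = 9) ↔
      ∃! i : Fin 4, (![
        M ≅ₘ Z 4,
        M ≅ₘ P9,
        M ≅ₘ (cycleMatroid (completeBipartiteGraph (Fin 3) (Fin 3))).dual,
        M ≅ₘ cycleMatroid (completeMinusEdge 3)] : Fin 4 → Prop) i) ∧
    IsPGComplement (Z 4) (cycleMatroid (⊤ : SimpleGraph (Fin 4))) ∧
    IsPGComplement P9 ((cycleMatroid (completeMinusEdge 2)).sum (U 1 1)) ∧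
    IsPGComplement (cycleMatroid (completeBipartiteGraph (Fin 3) (Fin 3))).dual
      ((U 2 3).sum (U 2 3)) ∧
    IsPGComplement (cycleMatroid (completeMinusEdge 3)) PU23U34 ∧
    -- (iii) 10 elements
    ((IsRankFourBinaryThreeConnected M ∧ M.E.encard = 10) ↔
      ∃! i : Fin 4, (![
        IsPGComplement M (cycleMatroid (completeMinusEdge 2)),
        IsPGComplement M ((U 2 3).sum (U 2 2)),
        IsPGComplement M ((U 3 4).sum (U 1 1)),
        M ≅ₘ cycleMatroid (⊤ : SimpleGraph (Fin 5))] : Fin 4 → Prop) i) ∧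
    IsPGComplement (cycleMatroid (⊤ : SimpleGraph (Fin 5))) (U 4 5) ∧
    HasPGComplement (cycleMatroid (completeMinusEdge 2)) ∧
    HasPGComplement ((U 2 3).sum (U 2 2)) ∧
    HasPGComplement ((U 3 4).sum (U 1 1)) ∧
    -- (iv) 11 elements
    ((IsRankFourBinaryThreeConnected M ∧ M.E.encard = 11) ↔
      ∃! i : Fin 3, (![
        IsPGComplement M ((U 2 3).sum (U 1 1)),
        IsPGComplement M (U 3 4),
        IsPGComplement M (U 4 4)] : Fin 3 → Prop) i) ∧
    HasPGComplement ((U 2 3).sum (U 1 1)) ∧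
    HasPGComplement (U 3 4) ∧
    HasPGComplement (U 4 4) ∧
    -- (v) more than 11 elements
    ((IsRankFourBinaryThreeConnected M ∧ 11 < M.E.encard) ↔
      ∃! i : Fin 5, (![
        IsPGComplement M (U 2 3),
        IsPGComplement M (U 3 3),
        IsPGComplement M (U 2 2),
        IsPGComplement M (U 1 1),
        M ≅ₘ PG 3] : Fin 5 → Prop) i) ∧
    HasPGComplement (U 2 3) ∧
    HasPGComplement (U 3 3) ∧
    HasPGComplement (U 2 2) ∧
    HasPGComplement (U 1 1) := by
  have lt : ∀ {i : ℕ}, i ≤ 19 → i < 20 := fun h => by omega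
  refine ⟨?_, ?_, ?_, ?_, ?_, ?_, ?_, ?_, ?_, ?_, ?_, ?_, ?_, ?_, ?_, ?_, ?_, ?_, ?_, ?_⟩
  · refine isRankFour_and_iff_existsUnique ![0, 1, 2, 3] (by decide) (by decide) (· ≤ 8)
      (fun s hs => by rw [hs]; exact Nat.cast_le_ofNat) (by decide) fun x => ?_
    fin_cases x
    exacts [isIso_congr_right isIso_F7_dual, isIso_congr_right isIso_S8,
      isIso_congr_right isIso_AG32, isIso_congr_right isIso_wheel]
  · refine isRankFour_and_iff_existsUnique ![4, 5, 6, 7] (by decide) (by decide) (· = 9)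
      (fun s hs => by rw [hs]; norm_cast) (by decide) fun x => ?_
    fin_cases x
    exacts [isIso_congr_right isIso_Z_four, isIso_congr_right isIso_P9,
      isIso_congr_right isIso_K_three_three_dual, isIso_congr_right isIso_K_five_minus]
  · exact isPGComplement_of_restrict (lt (by norm_num)) isIso_K_four isIso_Z_four
  · exact isPGComplement_of_restrict (lt (by norm_num)) isIso_K_four_minus_sum_U_one_one isIso_P9
  · exact isPGComplement_of_restrict (lt (by norm_num)) isIso_U_two_three_sum_U_two_three
      isIso_K_three_three_dual
  · exact isPGComplement_of_restrict (lt (by norm_num)) isIso_PU23U34 isIso_K_five_minus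
  · refine isRankFour_and_iff_existsUnique ![8, 9, 10, 11] (by decide) (by decide) (· = 10)
      (fun s hs => by rw [hs]; norm_cast) (by decide) fun x => ?_
    fin_cases x
    exacts [isPGComplement_iff (lt (by norm_num)) isIso_K_four_minus,
      isPGComplement_iff (lt (by norm_num)) isIso_U_two_three_sum_U_two_two,
      isPGComplement_iff (lt (by norm_num)) isIso_U_three_four_sum_U_one_one,
      isIso_congr_right isIso_K_five]
  · exact isPGComplement_of_restrict (lt (by norm_num)) isIso_U_four_five isIso_K_five
  · exact hasPGComplement_of_restrict (lt (by norm_num)) isIso_K_four_minus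
  · exact hasPGComplement_of_restrict (lt (by norm_num)) isIso_U_two_three_sum_U_two_two
  · exact hasPGComplement_of_restrict (lt (by norm_num)) isIso_U_three_four_sum_U_one_one
  · refine isRankFour_and_iff_existsUnique ![12, 13, 14] (by decide) (by decide) (· = 11)
      (fun s hs => by rw [hs]; norm_cast) (by decide) fun x => ?_
    fin_cases x
    exacts [isPGComplement_iff (lt (by norm_num)) isIso_U_two_three_sum_U_one_one,
      isPGComplement_iff (lt (by norm_num)) isIso_U_three_four,
      isPGComplement_iff (lt (by norm_num)) isIso_U_four_four]
  · exact hasPGComplement_of_restrict (lt (by norm_num)) isIso_U_two_three_sum_U_one_one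
  · exact hasPGComplement_of_restrict (lt (by norm_num)) isIso_U_three_four
  · exact hasPGComplement_of_restrict (lt (by norm_num)) isIso_U_four_four
  · refine isRankFour_and_iff_existsUnique ![15, 16, 17, 18, 19] (by decide) (by decide) (11 < ·)
      (fun s hs => by rw [hs]; exact Nat.ofNat_lt_cast) (by decide) fun x => ?_
    fin_cases x
    exacts [isPGComplement_iff (lt (by norm_num)) isIso_U_two_three,
      isPGComplement_iff (lt (by norm_num)) isIso_U_three_three,
      isPGComplement_iff (lt (by norm_num)) isIso_U_two_two,
      isPGComplement_iff (lt (by norm_num)) isIso_U_one_one,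
      isIso_congr_right isIso_PG_three]
  · exact hasPGComplement_of_restrict (lt (by norm_num)) isIso_U_two_three
  · exact hasPGComplement_of_restrict (lt (by norm_num)) isIso_U_three_three
  · exact hasPGComplement_of_restrict (lt (by norm_num)) isIso_U_two_two
  · exact hasPGComplement_of_restrict (lt (by norm_num)) isIso_U_one_one
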